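/- **Setting.** An abstract data type $T$ consists of a set of states $S$, a set $S_0\subseteq S$ of possible initial states, a set $\mathcal I$ of invocations, a set $\mathcal V$ of return values, and a transition relation $\delta\subseteq S\times\mathcal I\times\mathcal V\times S$ such that every invocation has at least one outcome in every state ($T$ may be non-deterministic). A history of an object is a finite or infinite sequence of invocation and response events of processes; it is well-formed if the events of each process alternate between invocations and responses, starting with an invocation. A sequential history is legal for an object with initial state $q\in S_0$ if it follows $\delta$ from $q$. A well-formed history $H$ is *weakly consistent* if for each operation $o$ that has a response in $H$, performed by a process $p$ say, there is a legal sequential history which contains only operations invoked in $H$ before $o$ returns, contains all operations of $p$ that precede $o$, and ends with $o$ and its response in $H$. For $t\ge 0$ let $H_t$ be $H$ without its first $t$ events. $H$ is *$t$-linearizable* if there is a (finite or infinite) legal sequential history $H_S$ such that every operation in $H_S$ is invoked in $H$; every operation completed in $H$ is completed in $H_S$; if the response of $o_1$ precedes the invocation of $o_2$, both events are in $H_t$, and $o_2$ is in $H_S$, then $o_1$ precedes $o_2$ in $H_S$; and every operation with a response in $H_t$ has the same response in $H_S$. $H$ is *linearizable* if it is $0$-linearizable, and *eventually linearizable* if it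 is weakly consistent and $t$-linearizable for some $t\ge 0$. An $n$-process *implementation* of an object consists of finitely many base objects with chosen possible initial states and a deterministic program for each of the $n$ processes, which may do arbitrary local computation and operations on the base objects. It is linearizable (eventually linearizable) if all histories of the implemented object, over all finite and infinite asynchronous executions in which the base objects behave as required, are so. It is *wait-free* if in all these executions each operation terminates within finitely many steps of the process performing it, regardless of the other processes. A data type is implemented if an object of it is implemented for each possible initial state. Read/write registers may hold values of any kind. The *fetch-and-cons* type has one operation $\mathrm{fac}(v)$, $v\in\mathbb N$, which adds $v$ to the head of a list, initially empty, and returns the list stored before; the *consensus* type has one operation $\mathrm{propose}(v)$, $v\in\mathbb N$, which always returns the first value proposed. The *classical consensus number* $c(T)\in\mathbb N\cup\{\infty\}$ is the largest $n$ such that linearizable objects of type $T$ and linearizable registers wait-free implement linearizable consensus for $n$ processes. The *eventual consensus number* $e(T)\in\mathbb N\cup\{\infty\}$ is the largest $n$ such that eventually linearizable objects of type $T$ and linearizable registers wait-free implement eventually linearizable fetch-and-cons for $n$ processes. Either number is $\infty$ if there is no largest such $n$. **Theorem.** For every abstract data type $T$, $$e(T)\le c(T).$$ Moreover, eventual consensus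 numbers induce a hierarchy of data types: if $T_1$ and $T_2$ are abstract data types with $e(T_1)<e(T_2)$, then for no $n>e(T_1)$ do eventually linearizable objects of type $T_1$ and linearizable registers wait-free implement the data type $T_2$, as an eventually linearizable object, for $n$ processes. -/

import Mathlib

universe u v

namespace SharedMemory

/-! ### Abstract data types -/

/-- An abstract data type: a labelled transition system with a set of possible initial states.
It may be non-deterministic; every invocation has at least one outcome in every state. -/
structure DataType where
  /-- states -/
  State : Type u
  /-- possible initial states -/
  init : Set State
  /-- invocations -/
  Inv : Type u
  /-- return values -/
  Val : Type u
  /-- `step s i v s'`: in state `s`, invocation `i` may return `v` and lead to state `s'` -/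
  step : State → Inv → Val → State → Prop
  total : ∀ s i, ∃ v s', step s i v s'

/-- The data type of a deterministic transition function. -/
def DataType.ofFun {S I V : Type u} (init : Set S) (δ : S → I → V × S) : DataType.{u} where
  State := S
  init := init
  Inv := I
  Val := V
  step s i v s' := δ s i = (v, s')
  total s i := ⟨(δ s i).1, (δ s i).2, rfl⟩

/-- Fetch-and-cons: `fac v` adds `v` to the head of the list and returns the previous list. -/
def fetchAndCons : DataType.{0} :=
  DataType.ofFun (S := List ℕ) (I := ℕ) (V := List ℕ) {[]} fun l v => (l, v :: l)

/-- Consensus: every `propose v` returns the value of the first proposal. -/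
def consensus : DataType.{0} :=
  DataType.ofFun (S := Option ℕ) (I := ℕ) (V := ℕ) {none}
    fun s v => (s.getD v, some (s.getD v))

inductive RegisterInv (A : Type u) : Type u
  | read
  | write (a : A)

/-- The response of a register to an invocation in state `a`, and its new state: a read returns
`some a`, a write returns the acknowledgement `none`. -/
def registerStep {A : Type u} (a : A) : RegisterInv A → Option A × A
  | .read => (some a, a)
  | .write b => (none, b)

/-- Multi-reader multi-writer read/write register with values in `A`. -/
def register (A : Type u) : DataType.{u} :=
  DataType.ofFun (S := A) (I := RegisterInv A) (V := Option A) Set.univ registerStep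

/-! ### Histories of one object

Processes are named by natural numbers. A history is laid out on a discrete time line with at most
one event per instant, so it is a finite or infinite sequence of events, and the subhistory of an
object or process is obtained by erasing the other events. An operation is named by the instant of
its invocation. -/

inductive Event (T : DataType.{u}) : Type u
  | inv (p : ℕ) (i : T.Inv)
  | res (p : ℕ) (v : T.Val)

/-- The process that performs the event. -/
def Event.proc {T : DataType.{u}} : Event T → ℕ
  | .inv p _ => p
  | .res p _ => p

abbrev History (T : DataType.{u}) : Type u := ℕ → Option (Event T)

namespace History

variable {T : DataType.{u}}

/-- No event of process `p` strictly between the instants `k` and `m`. -/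
def Quiet (h : History T) (p k m : ℕ) : Prop :=
  ∀ j, k < j → j < m → ∀ e, h j = some e → e.proc ≠ p

/-- The operation invoked at instant `k` returns `v` at instant `m`. -/
def Returns (h : History T) (k m : ℕ) (v : T.Val) : Prop :=
  ∃ p i, h k = some (.inv p i) ∧ k < m ∧ h m = some (.res p v) ∧ h.Quiet p k m

/-- For each process, its subhistory consists of alternating invocations and responses and starts
with an invocation. -/
def WellFormed (h : History T) : Prop :=
  (∀ p m v, h m = some (.res p v) → ∃ k, h.Returns k m v) ∧
  (∀ p k i k' i', k < k' → h k = some (.inv p i) → h k' = some (.inv p i') →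
    ∃ m v, m < k' ∧ h.Returns k m v)

/-- Instant `m` comes after the first `t` events of `h`; the events at such instants form the
suffix of `h` obtained by removing its first `t` events. -/
def InSuffix (h : History T) (t m : ℕ) : Prop :=
  t ≤ {j | j < m ∧ h j ≠ none}.ncard

/-- A finite or infinite sequence of (complete) operations of a history. `S j = some (k, v)`
says that slot `j` holds the operation invoked at instant `k`, with response `v`. Slots may be
empty. -/
abbrev Sequential (T : DataType.{u}) : Type u := ℕ → Option (ℕ × T.Val)

/-- `S` is a legal sequential history of an object of type `T` with initial state `q`, each of
its operations is invoked in `h`, and no operation occurs twice. -/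
def Legal (h : History T) (q : T.State) (S : Sequential T) : Prop :=
  (∀ j j' k v v', S j = some (k, v) → S j' = some (k, v') → j = j') ∧
  ∃ st : ℕ → T.State, st 0 = q ∧ ∀ j,
    (S j = none → st (j + 1) = st j) ∧
    (∀ k v, S j = some (k, v) →
      ∃ p i, h k = some (.inv p i) ∧ T.step (st j) i v (st (j + 1)))

/-- Every operation that has a response in `h` has an explanation: a legal sequential
history of operations invoked before that response, which contains all earlier operations of
the same process and ends with the operation and its response. -/
def WeaklyConsistent (h : History T) (q : T.State) : Prop :=
  ∀ k m v, h.Returns k m v → ∃ S : Sequential T, h.Legal q S ∧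
    (∀ j k' v', S j = some (k', v') → k' < m) ∧
    (∀ p i k' i', h k = some (.inv p i) → h k' = some (.inv p i') → k' < k →
      ∃ j v', S j = some (k', v')) ∧
    (∃ l, S l = some (k, v) ∧ ∀ j, l < j → S j = none)

/-- `S` is a `t`-linearization of `h`, for an object with initial state `q`. -/
structure IsLinearization (h : History T) (q : T.State) (t : ℕ) (S : Sequential T) : Prop where
  legal : h.Legal q S
  complete : ∀ k m v, h.Returns k m v → ∃ j v', S j = some (k, v')
  order : ∀ k₁ m₁ v₁ k₂ j₂ w₂, h.Returns k₁ m₁ v₁ → m₁ < k₂ →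
    h.InSuffix t m₁ → h.InSuffix t k₂ → S j₂ = some (k₂, w₂) →
    ∃ j₁ w₁, j₁ < j₂ ∧ S j₁ = some (k₁, w₁)
  response : ∀ k m v, h.Returns k m v → h.InSuffix t m → ∃ j, S j = some (k, v)

/-- `t`-linearizability of a well-formed history, for an object with initial state `q`. -/
def TLinearizable (h : History T) (q : T.State) (t : ℕ) : Prop :=
  h.WellFormed ∧ ∃ S, h.IsLinearization q t S

/-- Linearizability is `0`-linearizability. -/
def Linearizable (h : History T) (q : T.State) : Prop := h.TLinearizable q 0

/-- Eventual linearizability: weak consistency, and `t`-linearizability for some `t`. -/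
def EventuallyLinearizable (h : History T) (q : T.State) : Prop :=
  h.WellFormed ∧ h.WeaklyConsistent q ∧ ∃ t, h.TLinearizable q t

end History

/-- The two correctness conditions for shared objects. -/
inductive Consistency
  | linearizable
  | eventual

/-- The history `h` of an object with initial state `q` meets the condition. -/
def Consistency.Holds {T : DataType.{u}} (c : Consistency) (q : T.State) (h : History T) : Prop :=
  match c with
  | .linearizable => h.Linearizable q
  | .eventual => h.EventuallyLinearizable q

/-! ### Implementations -/

/-- What a process in local state does next: a local computation step, an operation on a base
object (with the local state that each possible response leads to), or the return of the
operation that it is performing. -/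
inductive Action {O : Type} (B : O → DataType.{u}) (V : Type v) (L : Type u) : Type (max u v)
  | compute (l : L)
  | call (o : O) (i : (B o).Inv) (next : (B o).Val → L)
  | ret (v : V) (l : L)

/-- The deterministic programs that the processes follow in order to implement an object of
type `X` from base objects of the types `B o`. The local state persists from one operation of a
process to its next one. -/
structure Program {O : Type} (B : O → DataType.{u}) (X : DataType.{v}) where
  /-- local states of a process -/
  Local : Type u
  /-- initial local state of each process -/
  init : ℕ → Local
  /-- how a process takes in an invocation of the implemented object -/
  start : ℕ → X.Inv → Local → Local
  /-- next action of a process that is performing an operation -/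
  act : ℕ → Local → Action B X.Val Local

/-- A process is between two operations, or performing an operation and about to act, or
waiting for the response of base object `o`. -/
inductive Status {O : Type} (B : O → DataType.{u}) (L : Type u) : Type u
  | idle (l : L)
  | running (l : L)
  | waiting (o : O) (next : (B o).Val → L)

section

variable {O : Type} {B : O → DataType.{u}} {X : DataType.{v}}

open Classical in
/-- Exactly one base object, `o`, has an event, namely `e`. -/
noncomputable def only (o : O) (e : Event (B o)) : ∀ o, Option (Event (B o)) :=
  Function.update (fun _ => none) o (some e)

/-- One instant of an execution. `M.Step c a x b c'` says that the statuses change from `c` to `c'`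
by a step of process `a` (or by no step), `x` is the event at the implemented object, and `b` gives
the event at each base object. Responses of base objects and invocations of the implemented object
are not restricted here. -/
inductive Program.Step (M : Program B X) : (ℕ → Status B M.Local) → Option ℕ →
    Option (Event X) → (∀ o, Option (Event (B o))) → (ℕ → Status B M.Local) → Prop
  | stutter (c) : Step M c none none (fun _ => none) c
  | invoke (c p i l) : c p = .idle l →
      Step M c (some p) (some (.inv p i)) (fun _ => none)
        (Function.update c p (.running (M.start p i l)))
  | compute (c p l l') : c p = .running l → M.act p l = .compute l' →
      Step M c (some p) none (fun _ => none) (Function.update c p (.running l'))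
  | call (c p l o i next) : c p = .running l → M.act p l = .call o i next →
      Step M c (some p) none (only o (.inv p i)) (Function.update c p (.waiting o next))
  | reply (c p o next v) : c p = .waiting o next →
      Step M c (some p) none (only o (.res p v)) (Function.update c p (.running (next v)))
  | ret (c p l v l') : c p = .running l → M.act p l = .ret v l' →
      Step M c (some p) (some (.res p v)) (fun _ => none) (Function.update c p (.idle l'))

/-- A finite or infinite execution of the program by the `n` processes `0, …, n - 1`, interleaved
arbitrarily, with arbitrary invocations of the implemented object. -/
structure Execution (M : Program B X) (n : ℕ) where
  /-- status of each process at each instant -/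
  status : ℕ → ℕ → Status B M.Local
  /-- the process, if any, that takes a step at each instant -/
  actor : ℕ → Option ℕ
  /-- history of the implemented object -/
  hist : History X
  /-- history of each base object -/
  base : ∀ o, History (B o)
  status_zero : ∀ p, status 0 p = .idle (M.init p)
  step : ∀ k, M.Step (status k) (actor k) (hist k) (fun o => base o k) (status (k + 1))
  actor_lt : ∀ k p, actor k = some p → p < n

/-- Every operation terminates after finitely many steps of the process performing it: if
process `p` takes infinitely many steps, then it is idle again after each instant. -/
def Execution.WaitFree {M : Program B X} {n : ℕ} (E : Execution M n) : Prop :=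
  ∀ p, {k | E.actor k = some p}.Infinite → ∀ k, ∃ k' ≥ k, ∃ l, E.status k' p = .idle l

end

/-- Base objects: objects of type `T`, indexed by `ι`, and registers, indexed by `ρ`. -/
abbrev withRegisters (T : DataType.{u}) (ι : Type) {ρ : Type} (R : ρ → Type u) :
    ι ⊕ ρ → DataType.{u}
  | .inl _ => T
  | .inr j => register (R j)

/-- For `n` processes, objects of type `T` that meet condition `c`, together with linearizable
registers, wait-free implement an object of type `X` that meets condition `c`, whichever initial
state `x₀` it has to have. An implementation consists of finitely many base objects
with chosen initial states, and a program. -/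
def Implements (c : Consistency) (n : ℕ) (T : DataType.{u}) (X : DataType.{v}) : Prop :=
  ∀ x₀ ∈ X.init, ∃ (ι ρ : Type) (_ : Finite ι) (_ : Finite ρ)
    (q : ι → T.State) (_ : ∀ j, q j ∈ T.init) (R : ρ → Type u) (r : ∀ j, R j)
    (M : Program (withRegisters T ι R) X), ∀ E : Execution M n,
      (∀ j : ι, c.Holds (T := T) (q j) (E.base (.inl j))) →
      (∀ j : ρ, History.Linearizable (T := register (R j)) (E.base (.inr j)) (r j)) →
      c.Holds x₀ E.hist ∧ E.WaitFree

/-! ### Consensus numbers -/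

/-- Classical consensus number: the largest number `n` of processes for which linearizable
objects of type `T` and registers wait-free implement linearizable consensus (`⊤` if there is no
largest one). -/
noncomputable def consensusNumber (T : DataType.{u}) : ℕ∞ :=
  ⨆ n ∈ {n : ℕ | Implements .linearizable n T consensus}, (n : ℕ∞)

/-- Eventual consensus number: the largest number `n` of processes for which eventually
linearizable objects of type `T` and linearizable registers wait-free implement eventually
linearizable fetch-and-cons (`⊤` if there is no largest one). -/
noncomputable def eventualConsensusNumber (T : DataType.{u}) : ℕ∞ :=
  ⨆ n ∈ {n : ℕ | Implements .eventual n T fetchAndCons}, (n : ℕ∞)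

end SharedMemory

open SharedMemory

/-!
Both parts rest on two facts: implementations compose, and eventually linearizable fetch-and-cons
together with registers implements *linearizable* consensus.

Composition (`ImplementsFrom.comp`): the composed program follows the outer program, but performs
each operation on a base object of the implemented type by following the inner program for that
object. An execution of it splits into an execution of the outer program and one of each inner
program on the same time line (`Compose.exists_executions`), so the conditions on the histories
pass from the inner programs to the outer one. For wait-freedom, a process that takes infinitely
many steps but only finitely many in the outer program would be stuck in a single inner operation.

Consensus (`implementsFrom_consensus`): the processes go through rounds of two stages. In the first
stage of a round, every process adds its current value to the fetch-and-cons list, and takes the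
oldest value of this stage that it finds there. The two stages are then a commit-adopt protocol in
registers: each process announces an entry in its register, and collects the entries of the others.
If two processes complete a stage, at least one sees the entry of the other
(`ConsensusAlgorithm.mem_or_mem`). This ensures that, if a process decides `d` in a round,
then all others decide `d` or pass it on to the next round (`ConsensusAlgorithm.next_of_done`).
Hence agreement holds however badly fetch-and-cons behaves, and validity needs no more than weak
consistency: only values that have been added to the list appear in it. After the list has
stabilized, all processes find the same oldest value in the first stage of a round. Then all
entries agree, and whoever completes the round decides (`ConsensusAlgorithm.waitFree`).

Linearizable objects are eventually linearizable. So if eventually linearizable objects of type `T`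
implement eventually linearizable fetch-and-cons, then linearizable ones do so too, and composing
that implementation with the consensus algorithm gives `e(T) ≤ c(T)`. Neither determinism of `T`
nor control over the states of its objects is needed, because no stable configuration has to be
reached: the algorithm is safe in all of them. The second part follows since an implementation of
`T₂` from `T₁` turns implementations of fetch-and-cons from `T₂` into such from `T₁`.
-/

universe w

namespace SharedMemory

/-! ### Histories -/

namespace History

variable {T : DataType.{u}} {X : DataType.{v}}

theorem inSuffix_zero (h : History T) (m : ℕ) : h.InSuffix 0 m := Nat.zero_le _

/-- An operation that is linearized before an operation `k` with a response is invoked before this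
response. -/
theorem IsLinearization.lt_of_returns {h : History T} {q : T.State} {S : Sequential T}
    (hS : h.IsLinearization q 0 S) {k m : ℕ} {v : T.Val} (hr : h.Returns k m v) {j j' k' : ℕ}
    {w v' : T.Val} (hj : S j = some (k, w)) (hj' : S j' = some (k', v')) (hle : j' ≤ j) :
    k' < m := by
  obtain ⟨huniq, st, hst0, hst⟩ := hS.legal
  by_contra hlt
  obtain ⟨p, i, hk', -⟩ := (hst j').2 k' v' hj'
  have hne : m ≠ k' := by
    rintro rfl
    obtain ⟨_, _, _, _, hm, _⟩ := hr
    rw [hk'] at hm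
    cases hm
  obtain ⟨j₁, w₁, hlt₁, hj₁⟩ := hS.order k m v k' j' v' hr (by omega) (h.inSuffix_zero _)
    (h.inSuffix_zero _) hj'
  have := huniq _ _ _ _ _ hj₁ hj
  omega

/-- A linearization, cut off after an operation, is an explanation of that operation. -/
theorem Linearizable.weaklyConsistent {h : History T} {q : T.State} (hl : h.Linearizable q) :
    h.WeaklyConsistent q := by
  obtain ⟨wf, S, hS⟩ := hl
  intro k m v hr
  obtain ⟨l, hl⟩ := hS.response k m v hr (h.inSuffix_zero m)
  obtain ⟨huniq, st, hst0, hst⟩ := hS.legal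
  have cut : ∀ {j x}, (if j ≤ l then S j else none) = some x → j ≤ l ∧ S j = some x := by
    intro j x hx
    split_ifs at hx with hj
    exact ⟨hj, hx⟩
  refine ⟨fun j => if j ≤ l then S j else none, ⟨?_, fun j => st (min j (l + 1)), ?_, ?_⟩,
    ?_, ?_, ?_⟩
  · intro j j' k v v' hj hj'
    exact huniq j j' k v v' (cut hj).2 (cut hj').2
  · simpa using hst0
  · intro j
    by_cases hj : j ≤ l
    · have h1 : min j (l + 1) = j := by omega
      have h2 : min (j + 1) (l + 1) = j + 1 := by omega
      simpa [hj, h1, h2] using hst j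
    · have h1 : min j (l + 1) = l + 1 := by omega
      have h2 : min (j + 1) (l + 1) = l + 1 := by omega
      simp [hj, h1, h2]
  · intro j k' v' hj
    obtain ⟨hjl, hj⟩ := cut hj
    exact hS.lt_of_returns hr hl hj hjl
  · intro p i k' i' hk hk' hlt
    obtain ⟨m', v', hm', hr'⟩ := wf.2 p k' i' k i hlt hk' hk
    obtain ⟨j₁, w₁, hlt₁, hj₁⟩ := hS.order k' m' v' k l v hr' hm' (h.inSuffix_zero _)
      (h.inSuffix_zero _) hl
    exact ⟨j₁, w₁, by simp [hlt₁.le, hj₁]⟩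
  · exact ⟨l, by simp [hl], fun j hj => by simp [Nat.not_le.2 hj]⟩

theorem Linearizable.eventuallyLinearizable {h : History T} {q : T.State}
    (hl : h.Linearizable q) : h.EventuallyLinearizable q :=
  ⟨hl.1, hl.weaklyConsistent, 0, hl⟩

end History

theorem Consistency.Holds.of_linearizable {T : DataType.{u}} {q : T.State} {h : History T}
    (hl : h.Linearizable q) : ∀ c : Consistency, c.Holds q h
  | .linearizable => hl
  | .eventual => hl.eventuallyLinearizable

/-- Translation of the invocations and return values of an event. -/
def Event.map {T : DataType.{u}} {X : DataType.{v}} (f : T.Inv → X.Inv) (g : T.Val → X.Val) :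
    Event T → Event X
  | .inv p i => .inv p (f i)
  | .res p v => .res p (g v)

/-- Translation of the invocations and return values of a history. -/
def History.map {T : DataType.{u}} {X : DataType.{v}} (f : T.Inv → X.Inv) (g : T.Val → X.Val)
    (h : History T) : History X := fun k => (h k).map (Event.map f g)

namespace History

variable {T : DataType.{u}} {X : DataType.{v}} {f : T.Inv → X.Inv} {g : T.Val → X.Val}
  {h : History T}

theorem map_eq_inv {k p : ℕ} {i : X.Inv} :
    h.map f g k = some (.inv p i) ↔ ∃ i₀, h k = some (.inv p i₀) ∧ f i₀ = i := by
  unfold History.map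
  rcases h k with _ | (⟨p', i'⟩ | ⟨p', v'⟩) <;> simp [Event.map]

theorem map_eq_res {k p : ℕ} {v : X.Val} :
    h.map f g k = some (.res p v) ↔ ∃ v₀, h k = some (.res p v₀) ∧ g v₀ = v := by
  unfold History.map
  rcases h k with _ | (⟨p', i'⟩ | ⟨p', v'⟩) <;> simp [Event.map]

theorem quiet_map {p k m : ℕ} : (h.map f g).Quiet p k m ↔ h.Quiet p k m := by
  unfold Quiet History.map
  refine forall₃_congr fun j _ _ => ?_
  rcases h j with _ | (⟨p', i'⟩ | ⟨p', v'⟩) <;> simp [Event.map, Event.proc]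

theorem returns_map {k m : ℕ} {v : X.Val} :
    (h.map f g).Returns k m v ↔ ∃ v₀, h.Returns k m v₀ ∧ g v₀ = v := by
  constructor
  · rintro ⟨p, i, hk, hlt, hm, hq⟩
    obtain ⟨i₀, hk, -⟩ := map_eq_inv.1 hk
    obtain ⟨v₀, hm, hv⟩ := map_eq_res.1 hm
    exact ⟨v₀, ⟨p, i₀, hk, hlt, hm, quiet_map.1 hq⟩, hv⟩
  · rintro ⟨v₀, ⟨p, i, hk, hlt, hm, hq⟩, hv⟩
    exact ⟨p, f i, map_eq_inv.2 ⟨i, hk, rfl⟩, hlt, map_eq_res.2 ⟨v₀, hm, hv⟩, quiet_map.2 hq⟩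

/-- Linearizability is preserved by homomorphisms of data types. -/
theorem Linearizable.map {q : T.State} (hl : h.Linearizable q) (s : T.State → X.State)
    (hs : ∀ a i v b, T.step a i v b → X.step (s a) (f i) (g v) (s b)) :
    (h.map f g).Linearizable (s q) := by
  obtain ⟨wf, S, hS⟩ := hl
  obtain ⟨huniq, st, hst0, hst⟩ := hS.legal
  have hmap : ∀ {j k v}, (S j).map (Prod.map id g) = some (k, v) →
      ∃ v₀, S j = some (k, v₀) ∧ g v₀ = v := by
    intro j k v hj
    rcases hSj : S j with _ | ⟨k', v'⟩
    · simp [hSj] at hj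
    · simp only [hSj, Option.map_some, Prod.map_apply, id, Option.some.injEq, Prod.mk.injEq] at hj
      exact ⟨v', by rw [hj.1], hj.2⟩
  refine ⟨⟨?_, ?_⟩, fun j => (S j).map (Prod.map id g), ?_, ?_, ?_, ?_⟩
  · intro p m v hm
    obtain ⟨v₀, hm, hv⟩ := map_eq_res.1 hm
    obtain ⟨k, hk⟩ := wf.1 p m v₀ hm
    exact ⟨k, returns_map.2 ⟨v₀, hk, hv⟩⟩
  · intro p k i k' i' hlt hk hk'
    obtain ⟨i₀, hk, -⟩ := map_eq_inv.1 hk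
    obtain ⟨i₁, hk', -⟩ := map_eq_inv.1 hk'
    obtain ⟨m, v, hm, hr⟩ := wf.2 p k i₀ k' i₁ hlt hk hk'
    exact ⟨m, g v, hm, returns_map.2 ⟨v, hr, rfl⟩⟩
  · refine ⟨?_, s ∘ st, by simp [hst0], fun j => ⟨?_, ?_⟩⟩
    · intro j j' k v v' hj hj'
      obtain ⟨_, hj, -⟩ := hmap hj
      obtain ⟨_, hj', -⟩ := hmap hj'
      exact huniq _ _ _ _ _ hj hj'
    · intro hj
      simp [(hst j).1 (by simpa using hj)]
    · intro k v hj
      obtain ⟨v₀, hj₀, rfl⟩ := hmap hj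
      obtain ⟨p, i, hk, hstep⟩ := (hst j).2 k v₀ hj₀
      exact ⟨p, f i, map_eq_inv.2 ⟨i, hk, rfl⟩, hs _ _ _ _ hstep⟩
  · intro k m v hr
    obtain ⟨v₀, hr, -⟩ := returns_map.1 hr
    obtain ⟨j, v', hj⟩ := hS.complete k m v₀ hr
    exact ⟨j, g v', by simp [hj]⟩
  · intro k₁ m₁ v₁ k₂ j₂ w₂ hr hlt _ _ hj
    obtain ⟨v₀, hr, -⟩ := returns_map.1 hr
    obtain ⟨w₀, hj, -⟩ := hmap hj
    obtain ⟨j₁, w₁, hlt₁, hj₁⟩ := hS.order k₁ m₁ v₀ k₂ j₂ w₀ hr hlt (h.inSuffix_zero _)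
      (h.inSuffix_zero _) hj
    exact ⟨j₁, g w₁, hlt₁, by simp [hj₁]⟩
  · intro k m v hr _
    obtain ⟨v₀, hr₀, rfl⟩ := returns_map.1 hr
    obtain ⟨j, hj⟩ := hS.response k m v₀ hr₀ (h.inSuffix_zero _)
    exact ⟨j, by simp [hj]⟩

end History

/-! ### Steps of a single process -/

section

variable {O : Type} {B : O → DataType.{u}} {X : DataType.{v}}

open Classical in
theorem only_self (o : O) (e : Event (B o)) : only o e o = some e := by
  simp [only]

open Classical in
theorem only_ne {o o' : O} (h : o' ≠ o) (e : Event (B o)) : only o e o' = none := by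
  simp [only, h]

theorem only_eq_some {o o' : O} {e : Event (B o)} {e' : Event (B o')}
    (h : only o e o' = some e') : o' = o := by
  by_contra hne
  simp [only_ne hne] at h

/-- The steps of process `p`, as a relation between its statuses before and after the step. -/
def Program.LocalStep (M : Program B X) (p : ℕ) : Status B M.Local → Option (Event X) →
    (∀ o, Option (Event (B o))) → Status B M.Local → Prop
  | .idle l, x, b, s' => ∃ i, x = some (.inv p i) ∧ b = (fun _ => none) ∧
      s' = .running (M.start p i l)
  | .running l, x, b, s' => match M.act p l with
    | .compute l' => x = none ∧ b = (fun _ => none) ∧ s' = .running l'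
    | .call o i next => x = none ∧ b = only o (.inv p i) ∧ s' = .waiting o next
    | .ret v l' => x = some (.res p v) ∧ b = (fun _ => none) ∧ s' = .idle l'
  | .waiting o next, x, b, s' => ∃ v, x = none ∧ b = only o (.res p v) ∧ s' = .running (next v)

theorem Program.LocalStep.step {M : Program B X} {p : ℕ} {c : ℕ → Status B M.Local}
    {x : Option (Event X)} {b : ∀ o, Option (Event (B o))} {s' : Status B M.Local}
    (h : M.LocalStep p (c p) x b s') : M.Step c (some p) x b (Function.update c p s') := by
  rcases hc : c p with l | l | ⟨o, next⟩
  · rw [hc] at h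
    obtain ⟨i, rfl, rfl, rfl⟩ := h
    exact .invoke c p i l hc
  · rw [hc] at h
    rcases ha : M.act p l with l' | ⟨o, i, next⟩ | ⟨v, l'⟩ <;>
      simp only [LocalStep, ha] at h <;> obtain ⟨rfl, rfl, rfl⟩ := h
    · exact .compute c p l l' hc ha
    · exact .call c p l o i next hc ha
    · exact .ret c p l v l' hc ha
  · rw [hc] at h
    obtain ⟨v, rfl, rfl, rfl⟩ := h
    exact .reply c p o next v hc

theorem Program.Step.cases {M : Program B X} {c c' : ℕ → Status B M.Local} {a : Option ℕ}
    {x : Option (Event X)} {b : ∀ o, Option (Event (B o))} (h : M.Step c a x b c') :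
    (a = none ∧ x = none ∧ b = (fun _ => none) ∧ c' = c) ∨
    ∃ p s', a = some p ∧ M.LocalStep p (c p) x b s' ∧ c' = Function.update c p s' := by
  cases h with
  | stutter => exact .inl ⟨rfl, rfl, rfl, rfl⟩
  | invoke p i l hc => exact .inr ⟨p, _, rfl, by rw [hc]; exact ⟨i, rfl, rfl, rfl⟩, rfl⟩
  | compute p l l' hc ha => exact .inr ⟨p, _, rfl, by simp [hc, LocalStep, ha], rfl⟩
  | call p l o i next hc ha => exact .inr ⟨p, _, rfl, by simp [hc, LocalStep, ha], rfl⟩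
  | reply p o next v hc => exact .inr ⟨p, _, rfl, by rw [hc]; exact ⟨v, rfl, rfl, rfl⟩, rfl⟩
  | ret p l v l' hc ha => exact .inr ⟨p, _, rfl, by simp [hc, LocalStep, ha], rfl⟩

/-- A step of process `p` or no step, according to whether the actor is `some p` or `none`. -/
def Program.WeakStep (M : Program B X) (p : ℕ) (a : Option ℕ) (s : Status B M.Local)
    (x : Option (Event X)) (b : ∀ o, Option (Event (B o))) (s' : Status B M.Local) : Prop :=
  (a = some p ∧ M.LocalStep p s x b s') ∨
    (a = none ∧ x = none ∧ b = (fun _ => none) ∧ s' = s)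

theorem Program.WeakStep.step {M : Program B X} {p : ℕ} {a : Option ℕ}
    {c : ℕ → Status B M.Local} {x : Option (Event X)} {b : ∀ o, Option (Event (B o))}
    {s' : Status B M.Local} (h : M.WeakStep p a (c p) x b s') :
    M.Step c a x b (Function.update c p s') := by
  rcases h with ⟨rfl, h⟩ | ⟨rfl, rfl, rfl, rfl⟩
  · exact h.step
  · rw [Function.update_eq_self]
    exact .stutter c

variable {M : Program B X}
  {c c' : ℕ → Status B M.Local} {a : Option ℕ} {x : Option (Event X)}
  {b : ∀ o, Option (Event (B o))}

theorem Program.Step.eq_of_ne (h : M.Step c a x b c') {p : ℕ} (hp : a ≠ some p) :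
    c' p = c p := by
  rcases h.cases with ⟨-, -, -, rfl⟩ | ⟨p', s', rfl, -, rfl⟩
  · rfl
  · exact Function.update_of_ne (by rintro rfl; exact hp rfl) _ _

theorem Program.Step.localStep {p : ℕ} (h : M.Step c (some p) x b c') :
    M.LocalStep p (c p) x b (c' p) := by
  rcases h.cases with ⟨h, -⟩ | ⟨p', s', h, hs, hc⟩
  · cases h
  · cases h
    simpa [hc] using hs

theorem Program.LocalStep.proc_base {p : ℕ} {s s' : Status B M.Local}
    (h : M.LocalStep p s x b s') {o : O} {e : Event (B o)} (he : b o = some e) : e.proc = p := by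
  rcases s with l | l | ⟨o', next⟩
  · obtain ⟨i, rfl, rfl, rfl⟩ := h
    cases he
  · rcases ha : M.act p l with l' | ⟨o', i, next⟩ | ⟨v, l'⟩ <;>
      simp only [LocalStep, ha] at h <;> obtain ⟨rfl, rfl, rfl⟩ := h
    · cases he
    · obtain rfl := only_eq_some he
      rw [only_self] at he
      cases he
      rfl
    · cases he
  · obtain ⟨v, rfl, rfl, rfl⟩ := h
    obtain rfl := only_eq_some he
    rw [only_self] at he
    cases he
    rfl

theorem Program.Step.actor_of_base (h : M.Step c a x b c') {o : O} {e : Event (B o)}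
    (he : b o = some e) : a = some e.proc := by
  rcases h.cases with ⟨-, -, rfl, -⟩ | ⟨p', s', rfl, hs, -⟩
  · cases he
  · rw [hs.proc_base he]

end

/-! ### Composition of implementations -/

/-- As `Implements`, for one initial state `x₀` of the implemented object, and with separate
conditions: `c₀` on the base objects of type `T`, and `c` on the implemented object. -/
def ImplementsFrom (c₀ c : Consistency) (n : ℕ) (T : DataType.{u}) (X : DataType.{v})
    (x₀ : X.State) : Prop :=
  ∃ (ι ρ : Type) (_ : Finite ι) (_ : Finite ρ)
    (q : ι → T.State) (_ : ∀ j, q j ∈ T.init) (R : ρ → Type u) (r : ∀ j, R j)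
    (M : Program (withRegisters T ι R) X), ∀ E : Execution M n,
      (∀ j : ι, c₀.Holds (T := T) (q j) (E.base (.inl j))) →
      (∀ j : ρ, History.Linearizable (T := register (R j)) (E.base (.inr j)) (r j)) →
      c.Holds x₀ E.hist ∧ E.WaitFree

namespace Compose

variable {T : DataType.{max u w}} {X : DataType.{w}} {Y : DataType.{v}} {ι ρ : Type}
  {R : ρ → Type w} (M : Program (withRegisters X ι R) Y) {ι' ρ' : ι → Type}
  {R' : ∀ j, ρ' j → Type (max u w)} (M' : ∀ j, Program (withRegisters T (ι' j) (R' j)) X)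

/-- Values of the registers of a composed program: those of the outer program, and those of the
inner programs. -/
abbrev Regs (R : ρ → Type w) (R' : ∀ j, ρ' j → Type (max u w)) :
    ρ ⊕ (Σ j, ρ' j) → Type (max u w) :=
  Sum.elim (fun r => ULift.{u} (R r)) (fun x => R' x.1 x.2)

/-- The invocation of a register with lifted values that stands for the given one. -/
def liftInv {A : Type w} : RegisterInv A → RegisterInv (ULift.{u} A)
  | .read => .read
  | .write a => .write ⟨a⟩

/-- The inverse of `liftInv`. -/
def lowerInv {A : Type w} : RegisterInv (ULift.{u} A) → RegisterInv A
  | .read => .read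
  | .write a => .write a.down

/-- The local state of a process in a composed program: its status in the outer program, and its
local state in each inner program. While it performs an operation of the inner program `j`, the
former is `waiting (inl j) _`. -/
abbrev Loc : Type (max u w) :=
  Status (withRegisters X ι R) M.Local × ∀ j, (M' j).Local

open Classical in
/-- The composed program: it follows `M`, but performs an operation on the base object `j` of
type `X` by following `M' j`. -/
noncomputable def program :
    Program (withRegisters T (Σ j, ι' j) (Regs R R')) Y where
  Local := Loc M M'
  init p := (.idle (M.init p), fun j => (M' j).init p)
  start p y l := match l with
    | (.idle a, f) => (.running (M.start p y a), f)
    | l => l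
  act p l := match l with
    | (.idle a, f) => .compute (.idle a, f)
    | (.running a, f) => match M.act p a with
      | .compute a' => .compute (.running a', f)
      | .call (.inl j) i next =>
          .compute (.waiting (.inl j) next, Function.update f j ((M' j).start p i (f j)))
      | .call (.inr r) i next =>
          .call (.inr (.inl r)) (liftInv i) fun v => (.running (next (v.map ULift.down)), f)
      | .ret v a' => .ret v (.idle a', f)
    | (.waiting (.inl j) next, f) => match (M' j).act p (f j) with
      | .compute a => .compute (.waiting (.inl j) next, Function.update f j a)
      | .call (.inl i) a nx =>
          .call (.inl ⟨j, i⟩) a fun v => (.waiting (.inl j) next, Function.update f j (nx v))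
      | .call (.inr r) a nx =>
          .call (.inr (.inr ⟨j, r⟩)) a fun v => (.waiting (.inl j) next, Function.update f j (nx v))
      | .ret v a => .compute (.running (next v), Function.update f j a)
    | (.waiting (.inr r) next, f) => .compute (.waiting (.inr r) next, f)

open Classical in
/-- The status of a process in the composed program, and the corresponding statuses in the outer
and inner programs. -/
inductive Rel : Status (withRegisters T (Σ j, ι' j) (Regs R R')) (Loc M M') →
    Status (withRegisters X ι R) M.Local →
    (∀ j, Status (withRegisters T (ι' j) (R' j)) (M' j).Local) → Prop
  | idle l f : Rel (.idle (.idle l, f)) (.idle l) (fun j => .idle (f j))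
  | running l f : Rel (.running (.running l, f)) (.running l) (fun j => .idle (f j))
  | register r next f :
      Rel (.waiting (.inr (.inl r)) fun v => (.running (next (v.map ULift.down)), f))
        (.waiting (.inr r) next) (fun j => .idle (f j))
  | inner j next f : Rel (.running (.waiting (.inl j) next, f)) (.waiting (.inl j) next)
      (Function.update (fun j' => .idle (f j')) j (.running (f j)))
  | innerObject j next f i nx :
      Rel (.waiting (.inl ⟨j, i⟩) fun v => (.waiting (.inl j) next, Function.update f j (nx v)))
        (.waiting (.inl j) next) (Function.update (fun j' => .idle (f j')) j (.waiting (.inl i) nx))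
  | innerRegister j next f r nx :
      Rel (.waiting (.inr (.inr ⟨j, r⟩)) fun v =>
          (.waiting (.inl j) next, Function.update f j (nx v)))
        (.waiting (.inl j) next) (Function.update (fun j' => .idle (f j')) j (.waiting (.inr r) nx))

/-- The events at the base objects of the outer program, given those at the base objects of the
composed program and those at the objects implemented by the inner programs. -/
def outerEvents (b : ∀ o, Option (Event (withRegisters T (Σ j, ι' j) (Regs R R') o)))
    (x : ι → Option (Event X)) : ∀ o, Option (Event (withRegisters X ι R o))
  | .inl j => x j
  | .inr r => (b (.inr (.inl r))).map (Event.map lowerInv (Option.map ULift.down))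

/-- The events at the base objects of the inner program `j`. -/
def innerEvents (b : ∀ o, Option (Event (withRegisters T (Σ j, ι' j) (Regs R R') o))) (j : ι) :
    ∀ o, Option (Event (withRegisters T (ι' j) (R' j) o))
  | .inl i => b (.inl ⟨j, i⟩)
  | .inr r => b (.inr (.inr ⟨j, r⟩))

theorem outerEvents_none : outerEvents (T := T) (R := R) (R' := R') (ι' := ι')
    (fun _ => none) (fun _ => none : ι → Option (Event X)) = fun _ => none := by
  funext o
  rcases o with j | r <;> rfl

theorem innerEvents_none (j : ι) : innerEvents (T := T) (R := R) (R' := R') (ι' := ι')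
    (fun _ => none) j = fun _ => none := by
  funext o
  rcases o with j | r <;> rfl

open Classical in
theorem outerEvents_update (j : ι) (e : Event X) : outerEvents (T := T) (R := R) (R' := R')
    (ι' := ι') (fun _ => none) (Function.update (fun _ => none) j (some e)) =
      only (B := withRegisters X ι R) (.inl j) e := by
  funext o
  rcases o with j' | r
  · by_cases h : j' = j
    · subst h
      rw [only_self]
      simp [outerEvents]
    · rw [only_ne (by simpa using h)]
      simp [outerEvents, h]
  · rw [only_ne (by simp)]
    rfl

theorem outerEvents_register (r : ρ) (e) : outerEvents (T := T) (R := R) (R' := R')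
    (ι' := ι') (only (.inr (.inl r)) e) (fun _ => none : ι → Option (Event X)) =
      only (B := withRegisters X ι R) (.inr r)
        (Event.map (X := register (R r)) lowerInv (Option.map ULift.down) e) := by
  funext o
  rcases o with j' | r'
  · rw [only_ne (by simp)]
    rfl
  · by_cases h : r' = r
    · subst h
      rw [only_self]
      simp [outerEvents, only_self]
    · rw [only_ne (by simpa using h)]
      simp only [outerEvents]
      rw [only_ne (by simpa using h)]
      rfl

theorem innerEvents_register (r : ρ) (e) (j : ι) : innerEvents (T := T) (R := R) (R' := R')
    (ι' := ι') (only (.inr (.inl r)) e) j = fun _ => none := by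
  funext o
  rcases o with j' | r' <;> exact only_ne (by simp) _

theorem outerEvents_innerObject (x : Σ j, ι' j) (e) : outerEvents (T := T) (R := R) (R' := R')
    (ι' := ι') (only (.inl x) e) (fun _ => none : ι → Option (Event X)) = fun _ => none := by
  funext o
  rcases o with j' | r'
  · rfl
  · simp only [outerEvents]
    rw [only_ne (by simp)]
    rfl

theorem outerEvents_innerRegister (x : Σ j, ρ' j) (e) : outerEvents (T := T) (R := R) (R' := R')
    (ι' := ι') (only (.inr (.inr x)) e) (fun _ => none : ι → Option (Event X)) =
      fun _ => none := by
  funext o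
  rcases o with j' | r'
  · rfl
  · simp only [outerEvents]
    rw [only_ne (by simp)]
    rfl

theorem innerEvents_innerObject (j : ι) (i : ι' j) (e) : innerEvents (T := T) (R := R)
    (R' := R') (ι' := ι') (only (.inl ⟨j, i⟩) e) j =
      only (B := withRegisters T (ι' j) (R' j)) (.inl i) e := by
  funext o
  rcases o with i' | r'
  · by_cases h : i' = i
    · subst h
      exact (only_self _ _).trans (only_self (B := withRegisters T (ι' j) (R' j)) (.inl i') e).symm
    · exact (only_ne (by simpa using h) _).trans
        (only_ne (B := withRegisters T (ι' j) (R' j))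
          (o := .inl i) (o' := .inl i') (by simpa using h) e).symm
  · exact (only_ne (by simp) _).trans
        (only_ne (B := withRegisters T (ι' j) (R' j))
          (o := .inl i) (o' := .inr r') (by simp) e).symm

theorem innerEvents_innerObject_ne {j j' : ι} (h : j' ≠ j) (i : ι' j) (e) :
    innerEvents (T := T) (R := R) (R' := R') (ι' := ι') (only (.inl ⟨j, i⟩) e) j' =
      fun _ => none := by
  funext o
  rcases o with i' | r' <;> exact only_ne (by simp [h]) _

theorem innerEvents_innerRegister (j : ι) (r : ρ' j) (e) : innerEvents (T := T) (R := R)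
    (R' := R') (ι' := ι') (only (.inr (.inr ⟨j, r⟩)) e) j =
      only (B := withRegisters T (ι' j) (R' j)) (.inr r) e := by
  funext o
  rcases o with i' | r'
  · exact (only_ne (by simp) _).trans
        (only_ne (B := withRegisters T (ι' j) (R' j))
          (o := .inr r) (o' := .inl i') (by simp) e).symm
  · by_cases h : r' = r
    · subst h
      exact (only_self _ _).trans (only_self (B := withRegisters T (ι' j) (R' j)) (.inr r') e).symm
    · exact (only_ne (by simpa using h) _).trans
        (only_ne (B := withRegisters T (ι' j) (R' j))
          (o := .inr r) (o' := .inr r') (by simpa using h) e).symm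

theorem innerEvents_innerRegister_ne {j j' : ι} (h : j' ≠ j) (r : ρ' j) (e) :
    innerEvents (T := T) (R := R) (R' := R') (ι' := ι') (only (.inr (.inr ⟨j, r⟩)) e) j' =
      fun _ => none := by
  funext o
  rcases o with i' | r' <;> exact only_ne (by simp [h]) _

variable {M M'}

theorem weakStep_idle (p : ℕ) (b)
    (hb : ∀ j, innerEvents (T := T) (R := R) (R' := R') (ι' := ι') b j = fun _ => none)
    (si : ∀ j, Status (withRegisters T (ι' j) (R' j)) (M' j).Local) (j : ι) :
    (M' j).WeakStep p none (si j) none (innerEvents b j) (si j) :=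
  .inr ⟨rfl, rfl, hb j, rfl⟩

open Classical in
/-- A step in the inner program `j` is no step in the other inner programs. -/
theorem weakStep_update {p : ℕ} {b} {j : ι} {x : Option (Event X)}
    {s s' : Status (withRegisters T (ι' j) (R' j)) (M' j).Local}
    (h : (M' j).LocalStep p s x (innerEvents (R := R) b j) s')
    (hb : ∀ j', j' ≠ j → innerEvents b j' = fun _ => none)
    {si si' : ∀ j, Status (withRegisters T (ι' j) (R' j)) (M' j).Local}
    (hs : si j = s) (hs' : si' j = s') (hsi : ∀ j', j' ≠ j → si' j' = si j') (j' : ι) :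
    (M' j').WeakStep p (if j' = j then some p else none) (si j')
      (Function.update (fun _ => none) j x j') (innerEvents b j') (si' j') := by
  by_cases hj : j' = j
  · subst hj
    refine .inl ⟨by simp, ?_⟩
    simpa [hs, hs'] using h
  · exact .inr ⟨by simp [hj], by simp [hj], hb j' hj, hsi j' hj⟩

open Classical in
/-- Every step of a composed program is a step of the outer program, or of one of the inner
programs, or of both: the outer program calls an object of type `X` when the corresponding inner
program takes in an invocation, and gets the response when the inner program returns. -/
theorem Rel.step {s so si} (hr : Rel M M' s so si) {p : ℕ} {x : Option (Event Y)} {b s'}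
    (h : (program M M').LocalStep p s x b s') : ∃ so' si' ao,
      ∃ (ai : ι → Option ℕ) (xi : ι → Option (Event X)), Rel M M' s' so' si' ∧
      M.WeakStep p ao so x (outerEvents b xi) so' ∧
      (∀ j, (M' j).WeakStep p (ai j) (si j) (xi j) (innerEvents b j) (si' j)) ∧
      (ao = some p ∨ ∃ j, ai j = some p) := by
  cases hr with
  | idle l f =>
    obtain ⟨i, rfl, rfl, rfl⟩ := h
    refine ⟨_, _, some p, fun _ => none, fun _ => none, .running (M.start p i l) f,
      .inl ⟨rfl, i, rfl, outerEvents_none, rfl⟩, weakStep_idle p _ innerEvents_none _, .inl rfl⟩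
  | running l f =>
    rcases ha : M.act p l with l' | ⟨j | r, i, next⟩ | ⟨v, l'⟩ <;>
      simp only [Program.LocalStep, program, ha] at h <;> obtain ⟨rfl, rfl, rfl⟩ := h
    · exact ⟨_, _, some p, fun _ => none, fun _ => none, .running l' f,
        .inl ⟨rfl, by
          simp only [Program.LocalStep, ha]
          exact ⟨trivial, outerEvents_none, trivial⟩⟩,
        weakStep_idle p _ innerEvents_none _, .inl rfl⟩
    · refine ⟨_, _, some p, _, _, .inner j next _, .inl ⟨rfl, ?_⟩,
        weakStep_update (j := j) (x := some (.inv p i))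
          (s := .idle (f j)) (s' := .running ((M' j).start p i (f j))) ?_ ?_ ?_ ?_ ?_, .inl rfl⟩
      · simp only [Program.LocalStep, ha]
        exact ⟨trivial, outerEvents_update j _, trivial⟩
      · exact ⟨i, rfl, innerEvents_none j, rfl⟩
      · exact fun j' _ => innerEvents_none j'
      · rfl
      · simp
      · intro j' hj
        simp [hj]
    · refine ⟨_, _, some p, fun _ => none, fun _ => none, .register r next f, .inl ⟨rfl, ?_⟩,
        weakStep_idle p _ (innerEvents_register r _) _, .inl rfl⟩
      simp only [Program.LocalStep, ha]
      refine ⟨trivial, (outerEvents_register r _).trans ?_, trivial⟩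
      cases i <;> rfl
    · exact ⟨_, _, some p, fun _ => none, fun _ => none, .idle l' f,
        .inl ⟨rfl, by
          simp only [Program.LocalStep, ha]
          exact ⟨trivial, outerEvents_none, trivial⟩⟩,
        weakStep_idle p _ innerEvents_none _, .inl rfl⟩
  | register r next f =>
    obtain ⟨v, rfl, rfl, rfl⟩ := h
    exact ⟨_, _, some p, fun _ => none, fun _ => none, .running _ f,
      .inl ⟨rfl, _, rfl, outerEvents_register r _, rfl⟩,
      weakStep_idle p _ (innerEvents_register r _) _, .inl rfl⟩
  | inner j next f =>
    rcases ha : (M' j).act p (f j) with l' | ⟨i | r, i', nx⟩ | ⟨v, l'⟩ <;>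
      simp only [Program.LocalStep, program, ha] at h <;> obtain ⟨rfl, rfl, rfl⟩ := h
    · refine ⟨_, _, none, _, _, .inner j next _, .inr ⟨rfl, rfl, ?_, rfl⟩,
        weakStep_update (j := j) (x := none) (s := .running (f j)) (s' := .running l')
          ?_ ?_ ?_ ?_ ?_, .inr ⟨j, if_pos rfl⟩⟩
      · rw [show Function.update (fun _ => none) j none = (fun _ : ι => (none : Option (Event X)))
          from Function.update_eq_self _ _]
        exact outerEvents_none
      · simp only [Program.LocalStep, ha]
        exact ⟨trivial, innerEvents_none j, trivial⟩
      · exact fun j' _ => innerEvents_none j'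
      · simp
      · simp
      · intro j' hj
        simp [hj]
    · refine ⟨_, _, none, _, _, .innerObject j next f i nx, .inr ⟨rfl, rfl, ?_, rfl⟩,
        weakStep_update (j := j) (x := none) (s := .running (f j)) (s' := .waiting (.inl i) nx)
          ?_ ?_ ?_ ?_ ?_, .inr ⟨j, if_pos rfl⟩⟩
      · rw [show Function.update (fun _ => none) j none = (fun _ : ι => (none : Option (Event X)))
          from Function.update_eq_self _ _]
        exact outerEvents_innerObject _ _
      · simp only [Program.LocalStep, ha]
        exact ⟨trivial, innerEvents_innerObject j i _, trivial⟩
      · exact fun j' hj => innerEvents_innerObject_ne hj i _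
      · simp
      · simp
      · intro j' hj
        simp [hj]
    · refine ⟨_, _, none, _, _, .innerRegister j next f r nx, .inr ⟨rfl, rfl, ?_, rfl⟩,
        weakStep_update (j := j) (x := none) (s := .running (f j)) (s' := .waiting (.inr r) nx)
          ?_ ?_ ?_ ?_ ?_, .inr ⟨j, if_pos rfl⟩⟩
      · rw [show Function.update (fun _ => none) j none = (fun _ : ι => (none : Option (Event X)))
          from Function.update_eq_self _ _]
        exact outerEvents_innerRegister _ _
      · simp only [Program.LocalStep, ha]
        exact ⟨trivial, innerEvents_innerRegister j r _, trivial⟩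
      · exact fun j' hj => innerEvents_innerRegister_ne hj r _
      · simp
      · simp
      · intro j' hj
        simp [hj]
    · refine ⟨_, _, some p, _, _, .running _ _, .inl ⟨rfl, v, rfl, outerEvents_update j _, rfl⟩,
        weakStep_update (j := j) (x := some (.res p v)) (s := .running (f j)) (s' := .idle l')
          ?_ ?_ ?_ ?_ ?_, .inl rfl⟩
      · simp only [Program.LocalStep, ha]
        exact ⟨trivial, innerEvents_none j, trivial⟩
      · exact fun j' _ => innerEvents_none j'
      · simp
      · simp
      · intro j' hj
        simp [hj]
  | innerObject j next f i nx =>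
    obtain ⟨v, rfl, rfl, rfl⟩ := h
    refine ⟨_, _, none, _, _, .inner j next _, .inr ⟨rfl, rfl, ?_, rfl⟩,
      weakStep_update (j := j) (x := none) (s := .waiting (.inl i) nx) (s' := .running (nx v))
        ?_ ?_ ?_ ?_ ?_, .inr ⟨j, if_pos rfl⟩⟩
    · rw [show Function.update (fun _ => none) j none = (fun _ : ι => (none : Option (Event X)))
        from Function.update_eq_self _ _]
      exact outerEvents_innerObject _ _
    · exact ⟨v, rfl, innerEvents_innerObject j i _, rfl⟩
    · exact fun j' hj => innerEvents_innerObject_ne hj i _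
    · simp
    · simp
    · intro j' hj
      simp [hj]
  | innerRegister j next f r nx =>
    obtain ⟨v, rfl, rfl, rfl⟩ := h
    refine ⟨_, _, none, _, _, .inner j next _, .inr ⟨rfl, rfl, ?_, rfl⟩,
      weakStep_update (j := j) (x := none) (s := .waiting (.inr r) nx) (s' := .running (nx v))
        ?_ ?_ ?_ ?_ ?_, .inr ⟨j, if_pos rfl⟩⟩
    · rw [show Function.update (fun _ => none) j none = (fun _ : ι => (none : Option (Event X)))
        from Function.update_eq_self _ _]
      exact outerEvents_innerRegister _ _
    · exact ⟨v, rfl, innerEvents_innerRegister j r _, rfl⟩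
    · exact fun j' hj => innerEvents_innerRegister_ne hj r _
    · simp
    · simp
    · intro j' hj
      simp [hj]

theorem Rel.idle_of_outer {s so si} (hr : Rel M M' s so si) {l} (h : so = .idle l) :
    ∃ l', s = .idle l' := by
  cases hr with
  | idle l f => exact ⟨_, rfl⟩
  | _ => cases h

open Classical in
theorem Rel.step_all {s s' : ℕ → Status (withRegisters T (Σ j, ι' j) (Regs R R')) (Loc M M')}
    {a x b} (h : (program M M').Step s a x b s')
    {so : ℕ → Status (withRegisters X ι R) M.Local}
    {si : ∀ j, ℕ → Status (withRegisters T (ι' j) (R' j)) (M' j).Local}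
    (hr : ∀ p, Rel M M' (s p) (so p) fun j => si j p) :
    ∃ (so' : ℕ → Status (withRegisters X ι R) M.Local)
      (si' : ∀ j, ℕ → Status (withRegisters T (ι' j) (R' j)) (M' j).Local)
      (ao : Option ℕ) (ai : ι → Option ℕ) (xi : ι → Option (Event X)),
      (∀ p, Rel M M' (s' p) (so' p) fun j => si' j p) ∧
      M.Step so ao x (outerEvents b xi) so' ∧
      (∀ j, (M' j).Step (si j) (ai j) (xi j) (innerEvents b j) (si' j)) ∧
      ∀ p, a = some p ↔ (ao = some p ∨ ∃ j, ai j = some p) := by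
  rcases h.cases with ⟨rfl, rfl, rfl, rfl⟩ | ⟨p, t, rfl, hs, rfl⟩
  · refine ⟨so, si, none, fun _ => none, fun _ => none, hr, ?_, fun j => ?_, by simp⟩
    · rw [outerEvents_none]
      exact .stutter so
    · rw [innerEvents_none]
      exact .stutter (si j)
  · obtain ⟨so', si', ao, ai, xi, hr', ho, hi, ha⟩ := (hr p).step hs
    refine ⟨Function.update so p so', fun j => Function.update (si j) p (si' j), ao, ai, xi,
      fun p' => ?_, ho.step, fun j => (hi j).step, fun p' => ?_⟩
    · by_cases hp : p' = p
      · subst hp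
        have hu : Function.update s p' t p' = t := Function.update_self ..
        refine Eq.mpr (congrArg (fun z => Rel M M' z _ _) hu) ?_
        simpa using hr'
      · have hu : Function.update s p t p' = s p' := Function.update_of_ne hp ..
        refine Eq.mpr (congrArg (fun z => Rel M M' z _ _) hu) ?_
        simpa [hp] using hr p'
    · have hao : ∀ p', ao = some p' → p' = p := by
        rintro p' rfl
        rcases ho with ⟨h, -⟩ | ⟨h, -⟩ <;> simp_all
      have hai : ∀ p' j, ai j = some p' → p' = p := by
        intro p' j hj
        rcases hi j with ⟨h, -⟩ | ⟨h, -⟩ <;> simp_all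
      constructor
      · rintro ⟨⟩
        exact ha
      · rintro (h | ⟨j, h⟩)
        · rw [hao _ h]
        · rw [hai _ _ h]

/-- An execution of a composed program yields executions of the outer program and of the inner
programs on the same time line, in which the inner programs implement the base objects of type `X`
of the outer one. -/
theorem exists_executions {n : ℕ} (E : Execution (program M M') n) :
    ∃ (Eo : Execution M n) (Ei : ∀ j, Execution (M' j) n),
      (∀ k p l, Eo.status k p = .idle l → ∃ l', E.status k p = .idle l') ∧
      (∀ k p, E.actor k = some p → Eo.actor k = some p ∨ ∃ j, (Ei j).actor k = some p) ∧
      Eo.hist = E.hist ∧ (∀ j, Eo.base (.inl j) = (Ei j).hist) ∧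
      (∀ r, Eo.base (.inr r) = History.map (X := register (R r)) lowerInv (Option.map ULift.down)
        (E.base (.inr (.inl r)))) ∧
      (∀ j i, (Ei j).base (.inl i) = E.base (.inl ⟨j, i⟩)) ∧
      (∀ j r, (Ei j).base (.inr r) = E.base (.inr (.inr ⟨j, r⟩))) := by
  let St : ℕ → Type (max u w) := fun k =>
    {c : (ℕ → Status (withRegisters X ι R) M.Local) ×
      (∀ j, ℕ → Status (withRegisters T (ι' j) (R' j)) (M' j).Local) //
      ∀ p, Rel M M' (E.status k p) (c.1 p) fun j => c.2 j p}
  have hstep : ∀ k (c : St k), ∃ (c' : St (k + 1)) (ao : Option ℕ) (ai : ι → Option ℕ)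
      (xi : ι → Option (Event X)),
      M.Step c.1.1 ao (E.hist k) (outerEvents (fun o => E.base o k) xi) c'.1.1 ∧
      (∀ j, (M' j).Step (c.1.2 j) (ai j) (xi j) (innerEvents (fun o => E.base o k) j)
        (c'.1.2 j)) ∧
      ∀ p, E.actor k = some p ↔ (ao = some p ∨ ∃ j, ai j = some p) := by
    rintro k ⟨c, hc⟩
    obtain ⟨so, si, ao, ai, xi, hr, h⟩ := Rel.step_all (E.step k) hc
    exact ⟨⟨(so, si), hr⟩, ao, ai, xi, h⟩
  choose next ao ai xi ho hi ha using hstep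
  have c₀ : ∃ c : St 0, (∀ p, c.1.1 p = .idle (M.init p)) ∧
      ∀ j p, c.1.2 j p = .idle ((M' j).init p) := by
    refine ⟨⟨(fun p => .idle (M.init p), fun j p => .idle ((M' j).init p)), fun p => ?_⟩,
      fun _ => rfl, fun _ _ => rfl⟩
    rw [E.status_zero]
    exact .idle _ _
  obtain ⟨c₀, hc₀, hc₀'⟩ := c₀
  let c : ∀ k, St k := fun k => Nat.rec c₀ next k
  let Eo : Execution M n :=
    { status := fun k => (c k).1.1
      actor := fun k => ao k (c k)
      hist := E.hist
      base := fun o k => outerEvents (fun o => E.base o k) (xi k (c k)) o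
      status_zero := hc₀
      step := fun k => ho k (c k)
      actor_lt := fun k p h => E.actor_lt k p ((ha k (c k) p).2 (.inl h)) }
  let Ei : ∀ j, Execution (M' j) n := fun j =>
    { status := fun k => (c k).1.2 j
      actor := fun k => ai k (c k) j
      hist := fun k => xi k (c k) j
      base := fun o k => innerEvents (fun o => E.base o k) j o
      status_zero := hc₀' j
      step := fun k => hi k (c k) j
      actor_lt := fun k p h => E.actor_lt k p ((ha k (c k) p).2 (.inr ⟨j, h⟩)) }
  exact ⟨Eo, Ei, fun k p l h => ((c k).2 p).idle_of_outer h, fun k p h => (ha k (c k) p).1 h,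
    rfl, fun _ => rfl, fun _ => rfl, fun _ _ => rfl, fun _ _ => rfl⟩

/-- If process `p` took infinitely many steps in the inner programs but only finitely many in the
outer one, then an inner program would get an invocation without a step of the outer one. -/
theorem waitFree {n : ℕ} [Finite ι] {E : Execution (program M M') n} {Eo : Execution M n}
    {Ei : ∀ j, Execution (M' j) n}
    (hidle : ∀ k p l, Eo.status k p = .idle l → ∃ l', E.status k p = .idle l')
    (hactor : ∀ k p, E.actor k = some p → Eo.actor k = some p ∨ ∃ j, (Ei j).actor k = some p)
    (hbase : ∀ j, Eo.base (.inl j) = (Ei j).hist)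
    (ho : Eo.WaitFree) (hi : ∀ j, (Ei j).WaitFree) : E.WaitFree := by
  intro p hp k
  by_cases hinf : {k | Eo.actor k = some p}.Infinite
  · obtain ⟨k', hk', l, hl⟩ := ho p hinf k
    obtain ⟨l', hl'⟩ := hidle k' p l hl
    exact ⟨k', hk', l', hl'⟩
  exfalso
  rw [Set.not_infinite] at hinf
  obtain ⟨K, hK⟩ := hinf.bddAbove
  have hsub : {k | E.actor k = some p} ⊆
      {k | Eo.actor k = some p} ∪ ⋃ j, {k | (Ei j).actor k = some p} := by
    intro k hk
    rcases hactor k p hk with h | ⟨j, h⟩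
    · exact .inl h
    · exact .inr (Set.mem_iUnion.2 ⟨j, h⟩)
  have hex : ∃ j, {k | (Ei j).actor k = some p}.Infinite := by
    by_contra! hno
    refine hp ((hinf.union (Set.finite_iUnion fun j => ?_)).subset hsub)
    exact hno j
  obtain ⟨j, hj⟩ := hex
  obtain ⟨k₁, hk₁, hl⟩ := hi j p hj (K + 1)
  have key : ∀ k', k₁ ≤ k' → (∃ l, (Ei j).status k' p = .idle l) →
      (Ei j).actor k' ≠ some p := by
    rintro k' hk' ⟨l, hl⟩ ha
    have hs := (Ei j).step k'
    rw [ha] at hs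
    have := hs.localStep
    rw [hl] at this
    obtain ⟨i, hx, -⟩ := this
    have hb := (Eo.step k').actor_of_base (o := .inl j) (e := .inv p i)
      (by rw [hbase j]; exact hx)
    have : k' ≤ K := hK (by simpa [Event.proc] using hb)
    omega
  have hall : ∀ d, ∃ l, (Ei j).status (k₁ + d) p = .idle l := by
    intro d
    induction d with
    | zero => exact hl
    | succ d ih =>
      obtain ⟨l, hl⟩ := ih
      exact ⟨l, (((Ei j).step (k₁ + d)).eq_of_ne (key _ (by omega) ⟨l, hl⟩)).trans hl⟩
  refine hj ((Set.finite_Iio k₁).subset fun k' hk' => ?_)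
  by_contra hlt
  have hle : k₁ ≤ k' := not_lt.1 hlt
  refine key k' hle ?_ hk'
  have := hall (k' - k₁)
  rwa [Nat.add_sub_cancel' hle] at this

end Compose

/-- Implementations compose. -/
theorem ImplementsFrom.comp {c₀ c₁ c₂ : Consistency} {n : ℕ} {T : DataType.{max u w}}
    {X : DataType.{w}} {Y : DataType.{v}} {y : Y.State}
    (hX : ∀ x ∈ X.init, ImplementsFrom c₀ c₁ n T X x) (hY : ImplementsFrom c₁ c₂ n X Y y) :
    ImplementsFrom c₀ c₂ n T Y y := by
  obtain ⟨ι, ρ, _, _, q, hq, R, r, M, hM⟩ := hY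
  choose ι' ρ' _ _ q' hq' R' r' M' hM' using fun j => hX (q j) (hq j)
  refine ⟨Σ j, ι' j, ρ ⊕ Σ j, ρ' j, inferInstance, inferInstance, fun x => q' x.1 x.2,
    fun x => hq' x.1 x.2, Compose.Regs R R',
    fun x => match x with
      | .inl a => ULift.up (r a)
      | .inr x => r' x.1 x.2, Compose.program M M', fun E hobj hreg => ?_⟩
  obtain ⟨Eo, Ei, hidle, hactor, hhist, hinl, hinr, hil, hir⟩ := Compose.exists_executions E
  have hi : ∀ j, c₁.Holds (q j) (Ei j).hist ∧ (Ei j).WaitFree := fun j =>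
    hM' j (Ei j) (fun i => by rw [hil]; exact hobj ⟨j, i⟩)
      (fun i => by rw [hir]; exact hreg (.inr ⟨j, i⟩))
  have ho : c₂.Holds y Eo.hist ∧ Eo.WaitFree := by
    refine hM Eo (fun j => by rw [hinl]; exact (hi j).1) fun j => ?_
    rw [hinr]
    refine (hreg (.inl j)).map (X := register (R j)) ULift.down ?_
    rintro a (_ | a') v b' h
    · cases h
      rfl
    · cases h
      rfl
  exact ⟨hhist ▸ ho.1, Compose.waitFree hidle hactor hinl ho.2 fun j => (hi j).2⟩

theorem Implements.mono {c : Consistency} {m n : ℕ} (hmn : m ≤ n) {T : DataType.{u}}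
    {X : DataType.{v}} (h : Implements c n T X) : Implements c m T X := by
  intro x hx
  obtain ⟨ι, ρ, hι, hρ, q, hq, R, r, M, hM⟩ := h x hx
  refine ⟨ι, ρ, hι, hρ, q, hq, R, r, M, fun E hobj hreg => ?_⟩
  let E' : Execution M n := { E with actor_lt := fun k p hp => (E.actor_lt k p hp).trans_le hmn }
  exact hM E' hobj hreg

/-- Base objects that are linearizable meet either condition. -/
theorem Implements.from_linearizable {c : Consistency} {n : ℕ} {T : DataType.{u}}
    {X : DataType.{v}} (h : Implements c n T X) {x : X.State} (hx : x ∈ X.init) :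
    ImplementsFrom .linearizable c n T X x := by
  obtain ⟨ι, ρ, hι, hρ, q, hq, R, r, M, hM⟩ := h x hx
  exact ⟨ι, ρ, hι, hρ, q, hq, R, r, M, fun E hobj hreg =>
    hM E (fun j => .of_linearizable (hobj j) c) hreg⟩

theorem Implements.trans {c : Consistency} {n : ℕ} {T X : DataType.{u}} {Y : DataType.{v}}
    (hX : Implements c n T X) (hY : Implements c n X Y) : Implements c n T Y :=
  fun y hy => ImplementsFrom.comp.{u, v, u} hX (hY y hy)

/-! ### Local states along an execution -/

namespace Execution

variable {O : Type} {B : O → DataType.{u}} {X : DataType.{v}} {M : Program B X} {n : ℕ}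
  (E : Execution M n) (p : ℕ)

/-- The local state of process `p`. While `p` waits for the response of a base object, it is the
local state in which `p` called that object. -/
def loc : ℕ → M.Local
  | 0 => M.init p
  | k + 1 => match E.status (k + 1) p with
    | .idle l => l
    | .running l => l
    | .waiting _ _ => loc k

variable {E p} {k : ℕ}

theorem loc_of_idle {l : M.Local} (h : E.status k p = .idle l) : E.loc p k = l := by
  cases k with
  | zero =>
    rw [E.status_zero] at h
    cases h
    rfl
  | succ k => simp [loc, h]

theorem loc_of_running {l : M.Local} (h : E.status k p = .running l) : E.loc p k = l := by
  cases k with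
  | zero =>
    rw [E.status_zero] at h
    cases h
  | succ k => simp [loc, h]

theorem loc_succ_of_waiting {o next} (h : E.status (k + 1) p = .waiting o next) :
    E.loc p (k + 1) = E.loc p k := by
  simp [loc, h]

/-- Either process `p` takes a step at instant `k`, or its status does not change. -/
theorem localStep_or (E : Execution M n) (p k : ℕ) :
    (E.actor k = some p ∧
      M.LocalStep p (E.status k p) (E.hist k) (fun o => E.base o k) (E.status (k + 1) p)) ∨
    (E.actor k ≠ some p ∧ E.status (k + 1) p = E.status k p) := by
  by_cases ha : E.actor k = some p
  · have h := E.step k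
    rw [ha] at h
    exact .inl ⟨ha, h.localStep⟩
  · exact .inr ⟨ha, (E.step k).eq_of_ne ha⟩

theorem loc_succ_of_status (h : E.status (k + 1) p = E.status k p) :
    E.loc p (k + 1) = E.loc p k := by
  rcases hs : E.status k p with l | l | ⟨o, next⟩
  · rw [loc_of_idle hs, loc_of_idle (h.trans hs)]
  · rw [loc_of_running hs, loc_of_running (h.trans hs)]
  · exact loc_succ_of_waiting (h.trans hs)

theorem actor_of_hist {e : Event X} (h : E.hist k = some e) : E.actor k = some e.proc := by
  rcases (E.step k).cases with ⟨-, hx, -⟩ | ⟨p', s', ha, hs, -⟩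
  · rw [hx] at h
    cases h
  rw [ha]
  rcases hst : E.status k p' with l | l | ⟨o, next⟩ <;> rw [hst] at hs
  · obtain ⟨i, hx, -⟩ := hs
    cases hx.symm.trans h
    rfl
  · rcases hact : M.act p' l with l' | ⟨o', i, next⟩ | ⟨v, l'⟩ <;>
      simp only [Program.LocalStep, hact] at hs <;> cases hs.1.symm.trans h
    rfl
  · obtain ⟨v, hx, -⟩ := hs
    cases hx.symm.trans h

theorem localStep_of_hist {e : Event X} (h : E.hist k = some e) :
    M.LocalStep e.proc (E.status k e.proc) (some e) (fun o => E.base o k)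
      (E.status (k + 1) e.proc) := by
  rcases E.localStep_or e.proc k with ⟨-, hs⟩ | ⟨hne, -⟩
  · rwa [h] at hs
  · exact absurd (actor_of_hist h) hne

theorem idle_of_inv {i : X.Inv} (h : E.hist k = some (.inv p i)) :
    E.status k p = .idle (E.loc p k) ∧ E.status (k + 1) p = .running (M.start p i (E.loc p k)) := by
  have hs : M.LocalStep p (E.status k p) _ _ (E.status (k + 1) p) := localStep_of_hist h
  rcases hst : E.status k p with l | l | ⟨o, next⟩ <;> rw [hst] at hs
  · obtain ⟨i', hx, -, hs'⟩ := hs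
    cases hx
    rw [loc_of_idle hst]
    exact ⟨rfl, hs'⟩
  · rcases hact : M.act p l with l' | ⟨o', i, next⟩ | ⟨v, l'⟩ <;>
      simp only [Program.LocalStep, hact] at hs <;> cases hs.1
  · obtain ⟨v, hx, -⟩ := hs
    cases hx

theorem running_of_res {v : X.Val} (h : E.hist k = some (.res p v)) :
    E.status k p = .running (E.loc p k) ∧ E.status (k + 1) p = .idle (E.loc p (k + 1)) ∧
      M.act p (E.loc p k) = .ret v (E.loc p (k + 1)) := by
  have hs : M.LocalStep p (E.status k p) _ _ (E.status (k + 1) p) := localStep_of_hist h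
  rcases hst : E.status k p with l | l | ⟨o, next⟩ <;> rw [hst] at hs
  · obtain ⟨i', hx, -⟩ := hs
    cases hx
  · rcases hact : M.act p l with l' | ⟨o', i, next⟩ | ⟨v, l'⟩ <;>
      simp only [Program.LocalStep, hact] at hs <;> cases hs.1
    rw [loc_of_running hst, loc_of_idle hs.2.2]
    exact ⟨rfl, hs.2.2, hact⟩
  · obtain ⟨v, hx, -⟩ := hs
    cases hx

theorem running_of_call {o : O} {i : (B o).Inv} (h : E.base o k = some (.inv p i)) :
    ∃ next, E.status k p = .running (E.loc p k) ∧ M.act p (E.loc p k) = .call o i next ∧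
      E.status (k + 1) p = .waiting o next := by
  have hs := E.step k
  rw [hs.actor_of_base h] at hs
  have hs : M.LocalStep p (E.status k p) _ _ (E.status (k + 1) p) := hs.localStep
  rcases hst : E.status k p with l | l | ⟨o', next⟩ <;> rw [hst] at hs
  · obtain ⟨i', -, hb, -⟩ := hs
    cases (congrFun hb o).symm.trans h
  · rcases hact : M.act p l with l' | ⟨o', i', next⟩ | ⟨v, l'⟩ <;>
      simp only [Program.LocalStep, hact] at hs <;> have hb := (congrFun hs.2.1 o).symm.trans h
    · cases hb
    · obtain rfl := only_eq_some hb
      rw [only_self] at hb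
      cases hb
      rw [loc_of_running hst]
      exact ⟨next, rfl, hact, hs.2.2⟩
    · cases hb
  · obtain ⟨v, -, hb, -⟩ := hs
    have hb := (congrFun hb o).symm.trans h
    obtain rfl := only_eq_some hb
    rw [only_self] at hb
    cases hb

/-- A waiting process has called the base object. -/
theorem exists_call_of_waiting {o next} (h : E.status k p = .waiting o next) :
    ∃ k₁ < k, ∃ i, M.act p (E.loc p k) = .call o i next ∧
      E.base o k₁ = some (.inv p i) ∧ (∀ j, k₁ < j → j ≤ k → E.status j p = .waiting o next) ∧
      ∀ j, k₁ ≤ j → j ≤ k → E.loc p j = E.loc p k := by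
  induction k with
  | zero =>
    rw [E.status_zero] at h
    cases h
  | succ k ih =>
    have hl := loc_succ_of_waiting h
    by_cases hst : E.status k p = .waiting o next
    · obtain ⟨k₁, hk₁, i, ha, hb, hw, hloc⟩ := ih hst
      refine ⟨k₁, hk₁.trans k.lt_succ_self, i, hl ▸ ha, hb, fun j h1 h2 => ?_,
        fun j h1 h2 => ?_⟩
      · rcases Nat.lt_or_eq_of_le h2 with h2 | rfl
        · exact hw j h1 (by omega)
        · exact h
      · rcases Nat.lt_or_eq_of_le h2 with h2 | rfl
        · rw [hl]
          exact hloc j h1 (by omega)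
        · rfl
    rcases E.localStep_or p k with ⟨-, hs⟩ | ⟨-, hs⟩
    swap
    · exact absurd (hs.symm.trans h) hst
    rw [h] at hs
    rcases hst : E.status k p with l | l | ⟨o', next'⟩ <;> rw [hst] at hs
    · obtain ⟨_, _, _, hs⟩ := hs
      cases hs
    · rcases hact : M.act p l with l' | ⟨o', i', next⟩ | ⟨v, l'⟩ <;>
        simp only [Program.LocalStep, hact] at hs <;> cases hs.2.2
      have hlk := loc_of_running hst
      refine ⟨k, k.lt_succ_self, i', by rw [hl, hlk, hact], ?_, fun j h1 h2 => ?_,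
        fun j h1 h2 => ?_⟩
      · rw [congrFun hs.2.1 o, only_self]
      · obtain rfl : j = k + 1 := by omega
        exact h
      · obtain rfl | rfl : j = k ∨ j = k + 1 := by omega
        · exact hl.symm
        · rfl
    · obtain ⟨_, _, _, hs⟩ := hs
      cases hs

/-- What may happen to the local state of a process at one instant. -/
theorem loc_succ (E : Execution M n) (p k : ℕ) :
    E.loc p (k + 1) = E.loc p k ∨
    (∃ i, E.hist k = some (.inv p i) ∧ E.loc p (k + 1) = M.start p i (E.loc p k)) ∨
    (E.status k p = .running (E.loc p k) ∧
      M.act p (E.loc p k) = .compute (E.loc p (k + 1))) ∨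
    (∃ k₁ < k, ∃ o i next v, M.act p (E.loc p k) = .call o i next ∧
      E.base o k₁ = some (.inv p i) ∧ (E.base o).Returns k₁ k v ∧
      (∀ j, k₁ ≤ j → j ≤ k → E.loc p j = E.loc p k) ∧ E.loc p (k + 1) = next v) ∨
    (∃ v, E.hist k = some (.res p v) ∧ E.status k p = .running (E.loc p k) ∧
      M.act p (E.loc p k) = .ret v (E.loc p (k + 1))) := by
  rcases E.localStep_or p k with ⟨-, hs⟩ | ⟨-, hs⟩
  swap
  · exact .inl (loc_succ_of_status hs)
  rcases hst : E.status k p with l | l | ⟨o, next⟩ <;> rw [hst] at hs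
  · obtain ⟨i, hx, -, hs⟩ := hs
    exact .inr (.inl ⟨i, hx, by rw [loc_of_running hs, loc_of_idle hst]⟩)
  · have hl := loc_of_running hst
    rcases hact : M.act p l with l' | ⟨o', i', next⟩ | ⟨v, l'⟩ <;>
      simp only [Program.LocalStep, hact] at hs
    · refine .inr (.inr (.inl ⟨by rw [hl], ?_⟩))
      rw [hl, loc_of_running hs.2.2, hact]
    · exact .inl (loc_succ_of_waiting hs.2.2)
    · refine .inr (.inr (.inr (.inr ⟨v, hs.1, by rw [hl], ?_⟩)))
      rw [hl, loc_of_idle hs.2.2, hact]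
  · obtain ⟨v, -, hb, hs⟩ := hs
    obtain ⟨k₁, hk₁, i, ha, hinv, hw, hloc⟩ := exists_call_of_waiting hst
    refine .inr (.inr (.inr (.inl ⟨k₁, hk₁, o, i, next, v, ha, hinv,
      ⟨p, i, hinv, hk₁, by rw [congrFun hb o, only_self], ?_⟩, hloc, loc_of_running hs⟩)))
    rintro j hj1 hj2 e he rfl
    have hstep := E.step j
    rw [hstep.actor_of_base he] at hstep
    have hls := hstep.localStep
    rw [hw j hj1 hj2.le, hw (j + 1) (by omega) hj2] at hls
    obtain ⟨_, _, _, hls⟩ := hls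
    cases hls

theorem not_idle_of_between {k₁ k₂ : ℕ}
    (h : ∀ j, k₁ < j → j ≤ k₂ → ∀ l, E.status j p ≠ .idle l) : E.hist.Quiet p k₁ k₂ := by
  rintro j hj1 hj2 (⟨p', i⟩ | ⟨p', v⟩) he rfl
  · exact h j hj1 hj2.le _ (idle_of_inv he).1
  · exact h (j + 1) (by omega) hj2 _ (running_of_res he).2.1

/-- The history of an implemented object is well-formed. -/
theorem hist_wellFormed (E : Execution M n) : E.hist.WellFormed := by
  have busy : ∀ p k, (∀ l, E.status k p ≠ .idle l) → ∃ k₁ < k, ∃ i,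
      E.hist k₁ = some (.inv p i) ∧ ∀ j, k₁ < j → j ≤ k → ∀ l, E.status j p ≠ .idle l := by
    intro p k
    induction k with
    | zero => exact fun h => absurd (E.status_zero p) (h _)
    | succ k ih =>
      intro h
      by_cases hk : ∃ l, E.status k p = .idle l
      · obtain ⟨l, hk⟩ := hk
        rcases E.localStep_or p k with ⟨-, hs⟩ | ⟨-, hs⟩
        · rw [hk] at hs
          obtain ⟨i, hx, -⟩ := hs
          refine ⟨k, k.lt_succ_self, i, hx, fun j h1 h2 => ?_⟩
          obtain rfl : j = k + 1 := by omega
          exact h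
        · exact absurd (hs.trans hk) (h l)
      · push Not at hk
        obtain ⟨k₁, hk₁, i, hinv, hj⟩ := ih hk
        refine ⟨k₁, by omega, i, hinv, fun j h1 h2 => ?_⟩
        rcases Nat.lt_or_eq_of_le h2 with h2 | rfl
        · exact hj j h1 (by omega)
        · exact h
  constructor
  · intro p m v hm
    have hr := running_of_res hm
    obtain ⟨k, hk, i, hinv, hj⟩ := busy p m fun l => by rw [hr.1]; simp
    exact ⟨k, p, i, hinv, hk, hm, not_idle_of_between hj⟩
  · intro p k i k' i' hlt hk hk'
    classical
    have hex : ∃ m, k < m ∧ ∃ l, E.status m p = .idle l := ⟨k', hlt, _, (idle_of_inv hk').1⟩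
    obtain ⟨hm, l, hl⟩ := Nat.find_spec hex
    have hmin : ∀ j, k < j → j < Nat.find hex → ∀ l, E.status j p ≠ .idle l :=
      fun j h1 h2 l hl => Nat.find_min hex h2 ⟨h1, l, hl⟩
    have hle : Nat.find hex ≤ k' := Nat.find_min' hex ⟨hlt, _, (idle_of_inv hk').1⟩
    obtain ⟨m, hmeq⟩ : ∃ m, Nat.find hex = m + 1 := ⟨Nat.find hex - 1, by omega⟩
    rw [hmeq] at hm hl hmin hle
    have hkm : k < m := by
      rcases Nat.lt_or_eq_of_le (Nat.lt_succ_iff.1 hm) with h | rfl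
      · exact h
      · rw [(idle_of_inv hk).2] at hl
        cases hl
    have hni := hmin m hkm m.lt_succ_self
    rcases E.localStep_or p m with ⟨-, hs⟩ | ⟨-, hs⟩
    · rw [hl] at hs
      rcases hst : E.status m p with l₀ | l₀ | ⟨o', next'⟩ <;> rw [hst] at hs
      · exact absurd hst (hni _)
      · rcases hact : M.act p l₀ with l' | ⟨o', i', next⟩ | ⟨v, l'⟩ <;>
          simp only [Program.LocalStep, hact] at hs <;> cases hs.2.2
        exact ⟨m, v, hle, p, i, hk, hkm, hs.1,
          not_idle_of_between fun j h1 h2 => hmin j h1 (by omega)⟩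
      · obtain ⟨_, _, _, hs⟩ := hs
        cases hs
    · exact absurd (hs.symm.trans hl) (hni l)

end Execution

/-! ### Registers with a single writer -/

namespace History

variable {A : Type u} {h : History (register A)} {r : A}

/-- The state of a register in a sequential history: the value of the last write. -/
theorem exists_last_write {S : Sequential (register A)} {st : ℕ → A} (h0 : st 0 = r)
    (hst : ∀ j, (S j = none → st (j + 1) = st j) ∧ (∀ k v, S j = some (k, v) →
      ∃ p i, h k = some (.inv p i) ∧ (register A).step (st j) i v (st (j + 1)))) (j : ℕ) :
    (st j = r ∨ ∃ j' < j, ∃ k v p, S j' = some (k, v) ∧ h k = some (.inv p (.write (st j)))) ∧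
    ∀ j₁ < j, ∀ k₁ v₁ p₁ a₁, S j₁ = some (k₁, v₁) → h k₁ = some (.inv p₁ (.write a₁)) →
      ∃ j' < j, j₁ ≤ j' ∧ ∃ k v p, S j' = some (k, v) ∧ h k = some (.inv p (.write (st j))) := by
  induction j with
  | zero => exact ⟨.inl h0, fun j₁ h => absurd h (Nat.not_lt_zero _)⟩
  | succ j ih =>
    have hcase : (st (j + 1) = st j ∧
        ∀ k v p a, S j = some (k, v) → h k ≠ some (.inv p (.write a))) ∨
        ∃ k v p, S j = some (k, v) ∧ h k = some (.inv p (.write (st (j + 1)))) := by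
      rcases hSj : S j with _ | ⟨k, v⟩
      · exact .inl ⟨(hst j).1 hSj, fun k v p a hS => by cases hS⟩
      · obtain ⟨p, i, hk, hs⟩ := (hst j).2 k v hSj
        rcases i with _ | a
        · refine .inl ⟨(congrArg Prod.snd hs).symm, fun k' v' p' a' hS hk' => ?_⟩
          cases hS
          cases hk.symm.trans hk'
        · have ha : st (j + 1) = a := (congrArg Prod.snd hs).symm
          exact .inr ⟨k, v, p, rfl, by rw [ha]; exact hk⟩
    rcases hcase with ⟨heq, hnw⟩ | ⟨k, v, p, hSj, hk⟩
    · rw [heq]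
      refine ⟨ih.1.imp_right ?_, fun j₁ hj₁ k₁ v₁ p₁ a₁ hS hk => ?_⟩
      · rintro ⟨j', hj', h⟩
        exact ⟨j', by omega, h⟩
      · rcases Nat.lt_succ_iff_lt_or_eq.1 hj₁ with hlt | rfl
        · obtain ⟨j', hj', h⟩ := ih.2 j₁ hlt k₁ v₁ p₁ a₁ hS hk
          exact ⟨j', by omega, h⟩
        · exact absurd hk (hnw _ _ _ _ hS)
    · exact ⟨.inr ⟨j, j.lt_succ_self, k, v, p, hSj, hk⟩, fun j₁ hj₁ _ _ _ _ _ _ =>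
        ⟨j, j.lt_succ_self, by omega, k, v, p, hSj, hk⟩⟩

/-- A read returns the initial value, or a value written by a write invoked before the read
returns. If there is only one writer, then that write does not precede any write completed before
the read is invoked. -/
theorem Linearizable.read (hl : h.Linearizable r) {k m q : ℕ} {v : Option A}
    (hk : h k = some (.inv q .read)) (hr : h.Returns k m v) : ∃ a, v = some a ∧
    (a = r ∨ ∃ k' < m, ∃ p, h k' = some (.inv p (.write a))) ∧
    ((∃ p₀, ∀ k p a, h k = some (.inv p (.write a)) → p = p₀) →
      ∀ k₁ m₁ p₁ a₁ w₁, h k₁ = some (.inv p₁ (.write a₁)) → h.Returns k₁ m₁ w₁ → m₁ < k →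
      ∃ k' < m, k₁ ≤ k' ∧ ∃ p, h k' = some (.inv p (.write a))) := by
  obtain ⟨wf, S, hS⟩ := hl
  obtain ⟨j, hj⟩ := hS.response k m v hr (h.inSuffix_zero m)
  obtain ⟨huniq, st, hst0, hst⟩ := hS.legal
  obtain ⟨p', i', hk', hstep⟩ := (hst j).2 k v hj
  cases hk.symm.trans hk'
  obtain ⟨hw1, hw2⟩ := exists_last_write hst0 hst j
  refine ⟨st j, (congrArg Prod.fst hstep).symm, hw1.imp_right ?_, ?_⟩
  · rintro ⟨j', hj', k', v', p, hSj', hk'⟩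
    exact ⟨k', hS.lt_of_returns hr hj hSj' hj'.le, p, hk'⟩
  · rintro ⟨p₀, hp₀⟩ k₁ m₁ p₁ a₁ w₁ hk₁ hr₁ hlt
    obtain ⟨j₁, w, hj₁, hSj₁⟩ := hS.order k₁ m₁ w₁ k j v hr₁ hlt (h.inSuffix_zero _)
      (h.inSuffix_zero _) hj
    obtain ⟨j', hj', hle, k', v', p, hSj', hk'⟩ := hw2 j₁ hj₁ _ _ _ _ hSj₁ hk₁
    refine ⟨k', hS.lt_of_returns hr hj hSj' hj'.le, ?_, p, hk'⟩
    by_contra hlt'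
    obtain rfl := hp₀ _ _ _ hk'
    obtain rfl := hp₀ _ _ _ hk₁
    obtain ⟨m', x', hm', hr'⟩ := wf.2 _ k' _ k₁ _ (by omega) hk' hk₁
    obtain ⟨j₂, w₂, hj₂, hSj₂⟩ := hS.order k' m' x' k₁ j₁ w hr' hm' (h.inSuffix_zero _)
      (h.inSuffix_zero _) hSj₁
    have := huniq _ _ _ _ _ hSj₂ hSj'
    omega

/-! ### Fetch-and-cons -/

variable {f : History fetchAndCons}

theorem Legal.exists_fac_states {q : List ℕ} {S : Sequential fetchAndCons} (hS : f.Legal q S) :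
    ∃ st : ℕ → List ℕ, st 0 = q ∧ ∀ j, (S j = none ∧ st (j + 1) = st j) ∨
      ∃ k p c, S j = some (k, st j) ∧ f k = some (.inv p c) ∧ st (j + 1) = c :: st j := by
  obtain ⟨-, st, hst0, hst⟩ := hS
  refine ⟨st, hst0, fun j => ?_⟩
  rcases hSj : S j with _ | ⟨k, v⟩
  · exact .inl ⟨rfl, (hst j).1 hSj⟩
  · obtain ⟨p, c, hk, hs⟩ := (hst j).2 k v hSj
    have hv : v = st j := (congrArg Prod.fst hs).symm
    exact .inr ⟨k, p, c, congrArg (fun v => some (k, v)) hv, hk, (congrArg Prod.snd hs).symm⟩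

/-- Only values that have been passed to fetch-and-cons appear in its responses. -/
theorem WeaklyConsistent.exists_fac (hf : f.WeaklyConsistent ([] : List ℕ)) {k m : ℕ}
    {l : List ℕ} (hr : f.Returns k m l) {c : ℕ} (hc : c ∈ l) :
    ∃ k' < m, ∃ p, f k' = some (.inv p c) := by
  obtain ⟨S, hS, hlt, -, j, hj, -⟩ := hf k m l hr
  obtain ⟨st, hst0, hst⟩ := hS.exists_fac_states
  have key : ∀ j, ∀ c ∈ st j, ∃ k' < m, ∃ p, f k' = some (.inv p c) := by
    intro j
    induction j with
    | zero => simp [hst0]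
    | succ j ih =>
      rcases hst j with ⟨-, h⟩ | ⟨k', p, c', hSj, hk', h⟩ <;> rw [h]
      · exact ih
      · intro c hc
        rcases List.mem_cons.1 hc with rfl | hc
        · exact ⟨k', hlt j k' _ hSj, p, hk'⟩
        · exact ih c hc
  rcases hst j with ⟨h, -⟩ | ⟨k', p, c', hSj, -, -⟩
  · cases hj.symm.trans h
  · cases hj.symm.trans hSj
    exact key j c hc

/-- The response to an operation contains everything that has been added by an earlier one. -/
theorem Legal.fac_suffix {q : List ℕ} {S : Sequential fetchAndCons} (hS : f.Legal q S)
    {j₁ j₂ k₁ k₂ : ℕ} {l₁ l₂ : List ℕ} (h₁ : S j₁ = some (k₁, l₁)) (h₂ : S j₂ = some (k₂, l₂))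
    (hlt : j₁ < j₂) {p₁ c₁ : ℕ} (hk₁ : f k₁ = some (.inv p₁ c₁)) : c₁ :: l₁ <:+ l₂ := by
  obtain ⟨st, -, hst⟩ := hS.exists_fac_states
  have hmono : ∀ d, st (j₁ + 1) <:+ st (j₁ + 1 + d) := by
    intro d
    induction d with
    | zero => exact List.suffix_rfl
    | succ d ih =>
      refine ih.trans ?_
      rw [← Nat.add_assoc]
      rcases hst (j₁ + 1 + d) with ⟨-, h⟩ | ⟨_, _, c, -, -, h⟩ <;> rw [h]
      exact List.suffix_cons c _
  have h := hmono (j₂ - (j₁ + 1))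
  rw [Nat.add_sub_cancel' hlt] at h
  rcases hst j₁ with ⟨h', -⟩ | ⟨k, p, c, hS₁, hk, hc⟩
  · cases h₁.symm.trans h'
  cases h₁.symm.trans hS₁
  cases hk₁.symm.trans hk
  rcases hst j₂ with ⟨h', -⟩ | ⟨k', p', c', hS₂, -, -⟩
  · cases h₂.symm.trans h'
  cases h₂.symm.trans hS₂
  rwa [hc] at h

end History

/-! ### Histories of consensus, infinite histories, and descent -/

namespace History

variable {T : DataType.{u}} {h : History T}

theorem Returns.invocation_unique {k k' m : ℕ} {v v' : T.Val} (hr : h.Returns k m v)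
    (hr' : h.Returns k' m v') : k = k' := by
  wlog hle : k ≤ k' generalizing k k' v v'
  · exact (this hr' hr (le_of_not_ge hle)).symm
  obtain ⟨p, i, hk, -, hm, hq⟩ := hr
  obtain ⟨p', i', hk', hlt', hm', -⟩ := hr'
  cases hm.symm.trans hm'
  by_contra hne
  exact hq k' (by omega) hlt' _ hk' rfl

theorem Returns.response_unique {k m m' : ℕ} {v v' : T.Val} (hr : h.Returns k m v)
    (hr' : h.Returns k m' v') : m = m' := by
  wlog hle : m ≤ m' generalizing m m' v v'
  · exact (this hr' hr (le_of_not_ge hle)).symm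
  obtain ⟨p, i, hk, hlt, hm, -⟩ := hr
  obtain ⟨p', i', hk', -, -, hq'⟩ := hr'
  cases hk.symm.trans hk'
  by_contra hne
  exact hq' m hlt (by omega) _ hm rfl

/-- A history of consensus is linearizable if all operations return the same value, and this value
has been proposed before the first response. -/
theorem linearizable_consensus {h : History consensus} (wf : h.WellFormed) {d k₀ q₀ : ℕ}
    (hk₀ : h k₀ = some (.inv q₀ d))
    (hall : ∀ m p v, h m = some (.res p v) → v = d ∧ k₀ < m) :
    h.Linearizable (none : Option ℕ) := by
  classical
  -- The operation `k₀` comes first. The others follow in the order of their responses: slot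
  -- `m + 1` holds the operation that returns at instant `m`.
  let S : Sequential consensus := fun j => match j with
    | 0 => some (k₀, d)
    | m + 1 => if hm : ∃ k, h.Returns k m d ∧ k ≠ k₀ then some (hm.choose, d) else none
  have ret : ∀ {k m v}, h.Returns k m v → v = d ∧ k₀ < m := by
    rintro k m v ⟨p, i, -, -, hm, -⟩
    exact hall m p v hm
  have Ssucc : ∀ {m k v}, S (m + 1) = some (k, v) ↔ h.Returns k m d ∧ k ≠ k₀ ∧ v = d := by
    intro m k v
    simp only [S]
    constructor
    · intro hS
      split_ifs at hS with hm
      have h1 : hm.choose = k := congrArg Prod.fst (Option.some.inj hS)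
      have h2 : d = v := congrArg Prod.snd (Option.some.inj hS)
      exact ⟨h1 ▸ hm.choose_spec.1, h1 ▸ hm.choose_spec.2, h2.symm⟩
    · rintro ⟨hr, hne, rfl⟩
      have hm : ∃ k, h.Returns k m v ∧ k ≠ k₀ := ⟨k, hr, hne⟩
      rw [dif_pos hm, hm.choose_spec.1.invocation_unique hr]
  have complete : ∀ k m v, h.Returns k m v → ∃ j, S j = some (k, v) ∧
      (k ≠ k₀ → j = m + 1) ∧ (k = k₀ → j = 0) := by
    intro k m v hr
    obtain ⟨rfl, -⟩ := ret hr
    by_cases hk : k = k₀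
    · subst hk
      exact ⟨0, rfl, fun h => absurd rfl h, fun _ => rfl⟩
    · exact ⟨m + 1, Ssucc.2 ⟨hr, hk, rfl⟩, fun _ => rfl, fun h => absurd h hk⟩
  refine ⟨wf, S, ⟨?_, fun j => match j with
    | 0 => (none : Option ℕ)
    | _ + 1 => some d, rfl, ?_⟩, ?_, ?_, ?_⟩
  · rintro (_ | m) (_ | m') k v v' hj hj'
    · rfl
    · have : k₀ = k := congrArg Prod.fst (Option.some.inj hj)
      exact absurd this.symm (Ssucc.1 hj').2.1
    · have : k₀ = k := congrArg Prod.fst (Option.some.inj hj')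
      exact absurd this.symm (Ssucc.1 hj).2.1
    · rw [(Ssucc.1 hj).1.response_unique (Ssucc.1 hj').1]
  · rintro (_ | m)
    · refine ⟨fun hS => (nomatch hS), fun k v hS => ?_⟩
      cases hS
      exact ⟨q₀, d, hk₀, rfl⟩
    · refine ⟨fun _ => rfl, fun k v hS => ?_⟩
      obtain ⟨⟨p, i, hk, -⟩, -, rfl⟩ := Ssucc.1 hS
      exact ⟨p, i, hk, rfl⟩
  · intro k m v hr
    obtain ⟨j, hj, -⟩ := complete k m v hr
    exact ⟨j, v, hj⟩
  · rintro k₁ m₁ v₁ k₂ (_ | m₂) w₂ hr hlt - - hS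
    · have : k₀ = k₂ := congrArg Prod.fst (Option.some.inj hS)
      have := (ret hr).2
      omega
    · obtain ⟨⟨_, _, _, hlt₂, _, _⟩, -, -⟩ := Ssucc.1 hS
      obtain ⟨j, hj, h1, h2⟩ := complete k₁ m₁ v₁ hr
      refine ⟨j, v₁, ?_, hj⟩
      by_cases hk : k₁ = k₀
      · rw [h2 hk]
        exact Nat.succ_pos _
      · rw [h1 hk]
        omega
  · intro k m v hr _
    obtain ⟨j, hj, -⟩ := complete k m v hr
    exact ⟨j, hj⟩

/-- In an infinite history, `InSuffix t` holds from some instant on. -/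
theorem exists_inSuffix (hinf : {j | h j ≠ none}.Infinite) (t : ℕ) :
    ∃ K, ∀ m ≥ K, h.InSuffix t m := by
  obtain ⟨F, hF, hcard⟩ := hinf.exists_subset_card_eq t
  refine ⟨F.sup id + 1, fun m hm => ?_⟩
  rw [InSuffix, ← hcard, ← Set.ncard_coe_finset]
  refine Set.ncard_le_ncard (fun j hj => ⟨?_, hF hj⟩)
    ((Set.finite_Iio m).subset fun j hj => hj.1)
  have : j ≤ F.sup id := Finset.le_sup (f := id) (Finset.mem_coe.1 hj)
  omega

end History

/-- A sequence of natural numbers that does not increase from some instant on cannot decrease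
infinitely often. -/
theorem not_strict_descent {f : ℕ → ℕ} {s : Set ℕ} (hs : s.Infinite) {K : ℕ}
    (hle : ∀ k ≥ K, f (k + 1) ≤ f k) (hlt : ∀ k ≥ K, k ∈ s → f (k + 1) < f k) : False := by
  have anti : ∀ {j k}, K ≤ j → j ≤ k → f k ≤ f j := by
    intro j k hj hjk
    induction k, hjk using Nat.le_induction with
    | base => exact le_rfl
    | succ k hk ih => exact (hle k (hj.trans hk)).trans ih
  have key : ∀ r, ∀ k ≥ K, ¬ f k ≤ r := by
    intro r
    induction r with
    | zero =>
      intro k hk hf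
      obtain ⟨k', hk', hkk'⟩ := hs.exists_gt k
      have h1 := hlt k' (by omega) hk'
      have h2 := anti hk hkk'.le
      omega
    | succ r ih =>
      intro k hk hf
      obtain ⟨k', hk', hkk'⟩ := hs.exists_gt k
      have h1 := hlt k' (by omega) hk'
      have h2 := anti hk hkk'.le
      exact ih (k' + 1) (by omega) (by omega)
  exact key _ K le_rfl le_rfl

/-! ### A consensus algorithm -/

namespace ConsensusAlgorithm

/-- What a process announces in one stage: a value, and a flag. -/
abbrev Entry : Type := ℕ × Bool

/-- The base objects: one fetch-and-cons object, and for each process a register for the list of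
all entries that the process has announced. -/
abbrev Base (n : ℕ) : Unit ⊕ Fin n → DataType.{0} :=
  withRegisters fetchAndCons Unit fun _ : Fin n => List Entry

/-- Local states of a process. The entries announced so far are recorded in `log`, so that
`log.length` is the number of the current stage. -/
inductive Loc : Type
  /-- no value has been proposed yet -/
  | fresh
  /-- about to perform fetch-and-cons at the beginning of a stage, with input `x` -/
  | ask (log : List Entry) (x : Entry)
  /-- about to announce the entry `e` -/
  | put (log : List Entry) (e : Entry)
  /-- having announced `e`, about to read the registers of the processes below `i`; the entries
  `acc` of the current stage have been seen in the others -/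
  | get (log : List Entry) (e : Entry) (i : ℕ) (acc : List Entry)
  /-- having decided `d` -/
  | done (log : List Entry) (d : ℕ)

/-- The entries that a process has announced, or is about to announce. -/
def Loc.log : Loc → List Entry
  | .fresh => []
  | .ask log _ => log
  | .put log e => log ++ [e]
  | .get log e _ _ => log ++ [e]
  | .done log _ => log

/-- A pair `(s, x)` is passed to fetch-and-cons in stage `s` by a process with input value `x`.
This is the value `x` of the first such pair for stage `s`, according to the response `l` to the
pair `c`. -/
def oldest (s c : ℕ) (l : List ℕ) : ℕ :=
  (((c :: l).filter fun c => c.unpair.1 = s).getLastD c).unpair.2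

theorem exists_oldest {s c : ℕ} {l : List ℕ} (hc : c.unpair.1 = s) :
    ∃ c' ∈ c :: l, c'.unpair.1 = s ∧ oldest s c l = c'.unpair.2 := by
  have hne : (c :: l).filter (fun c => c.unpair.1 = s) ≠ [] := by simp [hc]
  have hmem := List.getLast_mem hne
  rw [List.mem_filter] at hmem
  refine ⟨_, hmem.1, by simpa using hmem.2, ?_⟩
  rw [oldest, List.getLastD_eq_getLast?, List.getLast?_eq_some_getLast hne, Option.getD_some]

theorem oldest_eq_of_suffix {s c₁ c₂ : ℕ} {l₁ l₂ : List ℕ} (hc : c₁.unpair.1 = s)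
    (h : c₁ :: l₁ <:+ l₂) : oldest s c₁ l₁ = oldest s c₂ l₂ := by
  obtain ⟨l, hl⟩ := h.trans (List.suffix_cons c₂ l₂)
  have hne : (c₁ :: l₁).filter (fun c => c.unpair.1 = s) ≠ [] := by simp [hc]
  rw [oldest, oldest, ← hl, List.filter_append]
  simp only [List.getLastD_eq_getLast?]
  rw [List.getLast?_append_of_ne_nil _ hne, List.getLast?_eq_some_getLast hne]
  rfl

/-- The entry of a process with input `x` in stage `s`, if `l` is the response of the
fetch-and-cons object. -/
def entry (s : ℕ) (x : Entry) (l : List ℕ) : Entry :=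
  if Even s then (oldest s (Nat.pair s x.1) l, true) else x

/-- What a process does at the end of a stage in which it has announced `e` and has seen the
entries `acc`. In an even stage, it passes on its value, flagged if it has seen no other one. In an
odd stage, it decides its value if all entries that it has seen are flagged and have that value;
otherwise it passes on a flagged entry if it has seen one. -/
def next (log : List Entry) (e : Entry) (acc : List Entry) : Loc :=
  if Even log.length then .ask (log ++ [e]) (e.1, decide (∀ y ∈ acc, y.1 = e.1))
  else if ∀ y ∈ acc, y = (e.1, true) then .done (log ++ [e]) e.1
  else .ask (log ++ [e]) ((acc.find? fun y => y.2).getD e)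

/-- Rounds of two stages each. In the even stages, fetch-and-cons is used to choose a common value
(in the odd ones, its response is ignored). -/
def program (n : ℕ) : Program (Base n) consensus where
  Local := Loc
  init _ := .fresh
  start _ v
    | .fresh => .ask [] (v, true)
    | l => l
  act p
    | .fresh => .compute .fresh
    | .ask log x => .call (.inl ()) (Nat.pair log.length x.1) fun l =>
        .put log (entry log.length x l)
    | .put log e =>
        if h : p < n then
          .call (.inr ⟨p, h⟩) (RegisterInv.write (log ++ [e])) fun _ => .get log e n []
        else .compute (.put log e)
    | .get log e 0 acc => .compute (next log e acc)
    | .get log e (i + 1) acc =>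
        if h : i < n then
          .call (.inr ⟨i, h⟩) RegisterInv.read fun v =>
            .get log e i ((Option.getD v [])[log.length]?.toList ++ acc)
        else .compute (.get log e (i + 1) acc)
    | .done log d => .ret d (.done log d)

theorem log_next (log : List Entry) (e : Entry) (acc : List Entry) :
    (next log e acc).log = log ++ [e] := by
  unfold next
  split_ifs <;> rfl

variable {n : ℕ} (E : Execution (program n) n)

/-- The history of the fetch-and-cons object. -/
abbrev fac : History fetchAndCons := E.base (.inl ())

/-- The history of the register of process `i`. -/
abbrev reg (i : Fin n) : History (register (List Entry)) := E.base (.inr i)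

/-- `E.loc`, with its values in `Loc`. -/
abbrev loc (p k : ℕ) : Loc := E.loc p k

/-- The possible changes of the local state of a process at one instant. -/
theorem moves (p k : ℕ) :
    loc E p (k + 1) = loc E p k ∨
    (loc E p k = .fresh ∧ ∃ v, E.hist k = some (.inv p v) ∧ loc E p (k + 1) = .ask [] (v, true)) ∨
    (∃ log x, loc E p k = .ask log x ∧ ∃ k₁ < k, ∃ l,
      fac E k₁ = some (.inv p (Nat.pair log.length x.1)) ∧ (fac E).Returns k₁ k l ∧
      loc E p (k + 1) = .put log (entry log.length x l)) ∨
    (∃ log e, loc E p k = .put log e ∧ ∃ k₁, ∃ h : p < n, ∃ v,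
      reg E ⟨p, h⟩ k₁ = some (.inv p (.write (log ++ [e]))) ∧ (reg E ⟨p, h⟩).Returns k₁ k v ∧
      loc E p (k + 1) = .get log e n []) ∨
    (∃ log e i acc, loc E p k = .get log e (i + 1) acc ∧ ∃ k₁ < k, ∃ h : i < n, ∃ v,
      loc E p k₁ = .get log e (i + 1) acc ∧
      reg E ⟨i, h⟩ k₁ = some (.inv p .read) ∧ (reg E ⟨i, h⟩).Returns k₁ k v ∧
      loc E p (k + 1) = .get log e i ((Option.getD v [])[log.length]?.toList ++ acc)) ∨
    (∃ log e acc, loc E p k = .get log e 0 acc ∧ loc E p (k + 1) = next log e acc) := by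
  rcases E.loc_succ p k with h | ⟨i, hi, h⟩ | ⟨-, h⟩ | ⟨k₁, hk₁, o, i, nx, v, ha, hb, hr, hl, h⟩ |
    ⟨v, -, -, h⟩
  · exact .inl h
  · rcases hl : loc E p k with _ | ⟨log, x⟩ | ⟨log, e⟩ | ⟨log, e, i, acc⟩ | ⟨log, d⟩ <;>
      rw [show E.loc p k = _ from hl] at h
    · exact .inr (.inl ⟨rfl, i, hi, h⟩)
    all_goals exact .inl h
  · rcases hl : loc E p k with _ | ⟨log, x⟩ | ⟨log, e⟩ | ⟨log, e, _ | i, acc⟩ | ⟨log, d⟩ <;>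
      rw [show E.loc p k = _ from hl] at h
    · exact .inl (Action.compute.inj h).symm
    · cases h
    · simp only [program] at h
      split_ifs at h
      exact .inl (Action.compute.inj h).symm
    · exact .inr (.inr (.inr (.inr (.inr ⟨log, e, acc, rfl, (Action.compute.inj h).symm⟩))))
    · simp only [program] at h
      split_ifs at h
      exact .inl (Action.compute.inj h).symm
    · cases h
  · have hl₁ := hl k₁ le_rfl hk₁.le
    rcases hl : loc E p k with _ | ⟨log, x⟩ | ⟨log, e⟩ | ⟨log, e, _ | i, acc⟩ | ⟨log, d⟩ <;>
      rw [show E.loc p k = _ from hl] at ha hl₁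
    · cases ha
    · cases ha
      exact .inr (.inr (.inl ⟨log, x, rfl, k₁, hk₁, v, hb, hr, h⟩))
    · simp only [program] at ha
      split_ifs at ha with hp
      cases ha
      exact .inr (.inr (.inr (.inl ⟨log, e, rfl, k₁, hp, v, hb, hr, h⟩)))
    · cases ha
    · simp only [program] at ha
      split_ifs at ha with hi
      cases ha
      exact .inr (.inr (.inr (.inr (.inl
        ⟨log, e, i, acc, rfl, k₁, hk₁, hi, v, hl₁, hb, hr, h⟩))))
    · cases ha
  · rcases hl : loc E p k with _ | ⟨log, x⟩ | ⟨log, e⟩ | ⟨log, e, _ | i, acc⟩ | ⟨log, d⟩ <;>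
      rw [show E.loc p k = _ from hl] at h
    · cases h
    · cases h
    · simp only [program] at h
      split_ifs at h
    · cases h
    · simp only [program] at h
      split_ifs at h
    · exact .inl (Action.ret.inj h).2.symm

variable {E}

theorem loc_zero (p : ℕ) : loc E p 0 = .fresh := rfl

theorem log_mono {p j k : ℕ} (h : j ≤ k) : (loc E p j).log <+: (loc E p k).log := by
  induction k, h using Nat.le_induction with
  | base => exact List.prefix_rfl
  | succ k _ ih =>
    refine ih.trans ?_
    rcases moves E p k with h | ⟨h, v, -, h'⟩ | ⟨log, x, h, k₁, -, l, -, -, h'⟩ |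
      ⟨log, e, h, k₁, -, v, -, -, h'⟩ | ⟨log, e, i, acc, h, k₁, -, -, v, -, -, -, h'⟩ |
      ⟨log, e, acc, h, h'⟩
    · rw [h]
    · simp [h, Loc.log]
    · simp [h, h', Loc.log]
    · simp [h, h', Loc.log]
    · simp [h, h', Loc.log]
    · rw [h, h', log_next]
      exact List.prefix_rfl

/-- Process `p` has announced the entry `e` in stage `s`, or is about to do so at instant `k`. -/
def Ent (E : Execution (program n) n) (p s : ℕ) (e : Entry) (k : ℕ) : Prop :=
  (loc E p k).log[s]? = some e

theorem getElem?_of_prefix {α : Type*} {l₁ l₂ : List α} (h : l₁ <+: l₂) {s : ℕ} {a : α}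
    (ha : l₁[s]? = some a) : l₂[s]? = some a := by
  obtain ⟨l, rfl⟩ := h
  rw [List.getElem?_append_left (List.getElem?_eq_some_iff.1 ha).1, ha]

theorem Ent.mono {p s j k : ℕ} {e : Entry} (h : Ent E p s e j) (hjk : j ≤ k) : Ent E p s e k :=
  getElem?_of_prefix (log_mono hjk) h

theorem Ent.unique {p s j k : ℕ} {e e' : Entry} (h : Ent E p s e j) (h' : Ent E p s e' k) :
    e = e' := by
  have h₁ := h.mono (le_max_left j k)
  have h₂ := h'.mono (le_max_right j k)
  exact Option.some.inj (h₁.symm.trans h₂)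

theorem ent_get {p k i : ℕ} {log : List Entry} {e : Entry} {acc : List Entry}
    (h : loc E p k = .get log e i acc) : Ent E p log.length e k := by
  simp [Ent, h, Loc.log]

/-- The input of a stage is a proposal or comes from the preceding stage. -/
theorem ask_origin {p k : ℕ} {log : List Entry} {x : Entry} (h : loc E p k = .ask log x) :
    (log = [] ∧ ∃ k' < k, E.hist k' = some (.inv p x.1)) ∨
    ∃ k' < k, ∃ log₀ e acc, loc E p k' = .get log₀ e 0 acc ∧ next log₀ e acc = .ask log x := by
  induction k with
  | zero => cases h
  | succ k ih =>
    rcases moves E p k with h' | ⟨-, v, hv, h'⟩ | ⟨_, _, -, _, -, _, -, -, h'⟩ |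
      ⟨_, _, -, _, -, _, -, -, h'⟩ | ⟨_, _, _, _, -, _, -, -, _, -, -, -, h'⟩ |
      ⟨log₀, e, acc, hg, h'⟩ <;> rw [h] at h'
    · refine (ih h'.symm).imp ?_ ?_
      · rintro ⟨hl, k', hk', hi⟩
        exact ⟨hl, k', by omega, hi⟩
      · rintro ⟨k', hk', hi⟩
        exact ⟨k', by omega, hi⟩
    · cases h'
      exact .inl ⟨rfl, k, k.lt_succ_self, hv⟩
    · cases h'
    · cases h'
    · cases h'
    · exact .inr ⟨k, k.lt_succ_self, log₀, e, acc, hg, h'.symm⟩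

theorem done_origin {p k : ℕ} {log : List Entry} {d : ℕ} (h : loc E p k = .done log d) :
    ∃ k' < k, ∃ log₀ e acc, loc E p k' = .get log₀ e 0 acc ∧ next log₀ e acc = .done log d := by
  induction k with
  | zero => cases h
  | succ k ih =>
    rcases moves E p k with h' | ⟨-, v, hv, h'⟩ | ⟨_, _, -, _, -, _, -, -, h'⟩ |
      ⟨_, _, -, _, -, _, -, -, h'⟩ | ⟨_, _, _, _, -, _, -, -, _, -, -, -, h'⟩ |
      ⟨log₀, e, acc, hg, h'⟩ <;> rw [h] at h'
    · obtain ⟨k', hk', hi⟩ := ih h'.symm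
      exact ⟨k', by omega, hi⟩
    · cases h'
    · cases h'
    · cases h'
    · cases h'
    · exact ⟨k, k.lt_succ_self, log₀, e, acc, hg, h'.symm⟩

/-- Every entry has been computed from a response of the fetch-and-cons object. -/
theorem Ent.origin {p s k : ℕ} {e : Entry} (h : Ent E p s e k) :
    ∃ m < k, ∃ log x, loc E p m = .ask log x ∧ log.length = s ∧ ∃ k₁ l,
      fac E k₁ = some (.inv p (Nat.pair s x.1)) ∧ (fac E).Returns k₁ m l ∧
      e = entry s x l := by
  induction k with
  | zero => simp [Ent, loc_zero, Loc.log] at h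
  | succ k ih =>
    by_cases hk : Ent E p s e k
    · obtain ⟨m, hm, hi⟩ := ih hk
      exact ⟨m, by omega, hi⟩
    unfold Ent at h hk
    rcases moves E p k with h' | ⟨hl, v, hv, h'⟩ | ⟨log, x, hl, k₁, hk₁, l, hf, hr, h'⟩ |
      ⟨_, _, hl, _, -, _, -, -, h'⟩ | ⟨_, _, _, _, hl, _, -, -, _, -, -, -, h'⟩ |
      ⟨log₀, e, acc, hl, h'⟩
    · exact absurd (h' ▸ h) hk
    · rw [h'] at h
      simp [Loc.log] at h
    · rw [h'] at h
      rw [hl] at hk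
      simp only [Loc.log] at h hk
      have hs : log.length = s := by
        by_contra hne
        rcases lt_or_gt_of_ne hne with hlt | hlt
        · rw [List.getElem?_eq_none (by simpa using hlt)] at h
          cases h
        · rw [List.getElem?_append_left hlt] at h
          exact hk h
      subst hs
      simp only [List.getElem?_concat_length, Option.some.injEq] at h
      exact ⟨k, k.lt_succ_self, log, x, hl, rfl, k₁, l, hf, hr, h.symm⟩
    · rw [h'] at h
      rw [hl] at hk
      exact absurd h hk
    · rw [h'] at h
      rw [hl] at hk
      exact absurd h hk
    · rw [h', log_next] at h
      rw [hl] at hk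
      exact absurd h hk

theorem ask_of_fac {p k c : ℕ} (h : fac E k = some (.inv p c)) :
    ∃ log x, loc E p k = .ask log x ∧ c = Nat.pair log.length x.1 := by
  obtain ⟨nx, -, ha, -⟩ := Execution.running_of_call h
  rcases hl : loc E p k with _ | ⟨log, x⟩ | ⟨log, e⟩ | ⟨log, e, _ | i, acc⟩ | ⟨log, d⟩ <;>
      rw [show E.loc p k = _ from hl] at ha
  · cases ha
  · cases ha
    exact ⟨log, x, rfl, rfl⟩
  · simp only [program] at ha
    split_ifs at ha
    cases ha
  · cases ha
  · simp only [program] at ha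
    split_ifs at ha
    cases ha
  · cases ha

theorem put_of_write {p k : ℕ} {i : Fin n} {a : List Entry}
    (h : reg E i k = some (.inv p (.write a))) : p = i ∧ (loc E p k).log = a := by
  obtain ⟨nx, -, ha, -⟩ := Execution.running_of_call h
  rcases hl : loc E p k with _ | ⟨log, x⟩ | ⟨log, e⟩ | ⟨log, e, _ | i, acc⟩ | ⟨log, d⟩ <;>
      rw [show E.loc p k = _ from hl] at ha
  · cases ha
  · cases ha
  · simp only [program] at ha
    split_ifs at ha
    cases ha
    exact ⟨rfl, rfl⟩
  · cases ha
  · simp only [program] at ha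
    split_ifs at ha
    cases ha
  · cases ha

/-! ### Validity and agreement -/

/-- A read of the register of process `q` returns the entries that `q` has announced up to some
instant, and no fewer than in any write completed before the read. -/
theorem read_spec {q : Fin n} (hreg : (reg E q).Linearizable []) {k m p : ℕ}
    {v : Option (List Entry)} (hk : reg E q k = some (.inv p .read))
    (hr : (reg E q).Returns k m v) : ∃ a, v = some a ∧
      (∀ s y, a[s]? = some y → Ent E q s y m) ∧
      ∀ k₁ m₁ p₁ a₁ w₁, reg E q k₁ = some (.inv p₁ (.write a₁)) → (reg E q).Returns k₁ m₁ w₁ →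
        m₁ < k → a₁ <+: a := by
  obtain ⟨a, rfl, h1, h2⟩ := hreg.read hk hr
  refine ⟨a, rfl, fun s y hy => ?_, fun k₁ m₁ p₁ a₁ w₁ hk₁ hr₁ hlt => ?_⟩
  · rcases h1 with rfl | ⟨k', hk', p', hw⟩
    · cases hy
    · obtain ⟨rfl, rfl⟩ := put_of_write hw
      exact Ent.mono hy hk'.le
  · obtain ⟨k', -, hle, p', hw⟩ := h2 ⟨q, fun k p a h => (put_of_write h).1⟩
      k₁ m₁ p₁ a₁ w₁ hk₁ hr₁ hlt
    obtain ⟨rfl, rfl⟩ := put_of_write hk₁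
    obtain ⟨rfl, rfl⟩ := put_of_write hw
    exact log_mono hle

/-- While a process collects entries, its own one has been written at some instant `m₀`, and each
process whose entry it has not seen has been read after `m₀`. -/
theorem get_spec (hreg : ∀ i, (reg E i).Linearizable []) {p k i : ℕ} {log : List Entry}
    {e : Entry} {acc : List Entry} (h : loc E p k = .get log e i acc) :
    i ≤ n ∧ ∃ (hp : p < n) (k₀ m₀ : ℕ) (w : Option (List Entry)), m₀ < k ∧
      reg E ⟨p, hp⟩ k₀ = some (.inv p (.write (log ++ [e]))) ∧ (reg E ⟨p, hp⟩).Returns k₀ m₀ w ∧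
      (∀ y ∈ acc, ∃ q < n, Ent E q log.length y k) ∧
      ∀ q (hq : q < n), i ≤ q → (∃ y ∈ acc, Ent E q log.length y k) ∨
        ∃ k₁ m₁ a, reg E ⟨q, hq⟩ k₁ = some (.inv p .read) ∧
          (reg E ⟨q, hq⟩).Returns k₁ m₁ (some a) ∧ m₀ < k₁ ∧ a[log.length]? = none := by
  induction k using Nat.strong_induction_on generalizing i acc with
  | _ k ih =>
  rcases k with _ | k
  · cases h
  rcases moves E p k with h' | ⟨-, v, hv, h'⟩ | ⟨_, _, -, _, -, _, -, -, h'⟩ |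
    ⟨log', e', hl, k₁, hp, v, hw, hr, h'⟩ |
    ⟨log', e', i', acc', hl, k₁, hk₁, hi, v, hl₁, hrd, hr, h'⟩ | ⟨log', e', acc', hl, h'⟩ <;>
    rw [h] at h'
  · obtain ⟨hi, hp, k₀, m₀, w, hm, hw, hr, hacc, hq⟩ := ih k k.lt_succ_self h'.symm
    refine ⟨hi, hp, k₀, m₀, w, by omega, hw, hr, fun y hy => ?_, fun q hqn hqi => ?_⟩
    · obtain ⟨q, hqn, hE⟩ := hacc y hy
      exact ⟨q, hqn, hE.mono k.le_succ⟩
    · exact (hq q hqn hqi).imp_left fun ⟨y, hy, hE⟩ => ⟨y, hy, hE.mono k.le_succ⟩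
  · cases h'
  · cases h'
  · cases h'
    exact ⟨le_rfl, hp, k₁, k, v, k.lt_succ_self, hw, hr, by simp, fun q hq hle =>
      absurd hq (not_lt.2 hle)⟩
  · cases h'
    obtain ⟨-, hp, k₀, m₀, w, hm, hw, hr₀, hacc, hq⟩ := ih k₁ (by omega) hl₁
    obtain ⟨a, rfl, ha, -⟩ := read_spec (hreg _) hrd hr
    simp only [Option.getD_some]
    refine ⟨hi.le, hp, k₀, m₀, w, by omega, hw, hr₀, fun y hy => ?_, fun q hqn hqi => ?_⟩
    · rcases List.mem_append.1 hy with hy | hy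
      · exact ⟨i, hi, (ha _ _ (Option.mem_toList.1 hy)).mono k.le_succ⟩
      · obtain ⟨q, hqn, hE⟩ := hacc y hy
        exact ⟨q, hqn, hE.mono (by omega)⟩
    · rcases Nat.lt_or_eq_of_le hqi with hlt | rfl
      · refine (hq q hqn hlt).imp_left fun ⟨y, hy, hE⟩ =>
          ⟨y, List.mem_append_right _ hy, hE.mono (by omega)⟩
      · rcases hs : a[log.length]? with _ | y
        · exact .inr ⟨k₁, k, a, hrd, hr, hm, hs⟩
        · exact .inl ⟨y, by simp, (ha _ _ hs).mono k.le_succ⟩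
  · unfold next at h'
    split_ifs at h'

/-- Of two processes that have collected the entries of a stage, at least one has seen the entry
of the other: the one whose write was completed last has read after both writes. -/
theorem mem_or_mem (hreg : ∀ i, (reg E i).Linearizable []) {p q k k' : ℕ}
    {log log' : List Entry} {e e' : Entry} {acc acc' : List Entry}
    (h : loc E p k = .get log e 0 acc) (h' : loc E q k' = .get log' e' 0 acc')
    (hs : log.length = log'.length) : e' ∈ acc ∨ e ∈ acc' := by
  obtain ⟨-, hp, k₀, m₀, w, -, hw, hr, -, hq⟩ := get_spec hreg h
  obtain ⟨-, hq', k₀', m₀', w', -, hw', hr', -, hp'⟩ := get_spec hreg h'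
  rcases hq q hq' (Nat.zero_le _) with ⟨y, hy, hE⟩ | ⟨k₁, m₁, a, hrd, hra, hlt, ha⟩
  · rw [hs] at hE
    rw [← hE.unique (ent_get h')]
    exact .inl hy
  rcases hp' p hp (Nat.zero_le _) with ⟨y, hy, hE⟩ | ⟨k₁', m₁', a', hrd', hra', hlt', ha'⟩
  · rw [← hs] at hE
    rw [← hE.unique (ent_get h)]
    exact .inr hy
  exfalso
  have h1 : k₁ ≤ m₀' := by
    by_contra hlt₁
    obtain ⟨b, hb, -, hpre⟩ := read_spec (hreg _) hrd hra
    cases hb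
    have := getElem?_of_prefix (hpre _ _ _ _ _ hw' hr' (not_le.1 hlt₁))
      (List.getElem?_concat_length (l := log') (a := e'))
    rw [← hs, ha] at this
    cases this
  have h2 : k₁' ≤ m₀ := by
    by_contra hlt₁
    obtain ⟨b, hb, -, hpre⟩ := read_spec (hreg _) hrd' hra'
    cases hb
    have := getElem?_of_prefix (hpre _ _ _ _ _ hw hr (not_le.1 hlt₁))
      (List.getElem?_concat_length (l := log) (a := e))
    rw [hs, ha'] at this
    cases this
  omega

theorem self_mem (hreg : ∀ i, (reg E i).Linearizable []) {p k : ℕ} {log : List Entry} {e : Entry}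
    {acc : List Entry} (h : loc E p k = .get log e 0 acc) : e ∈ acc :=
  (mem_or_mem hreg h h rfl).elim id id

/-- The value of an entry is an input value of the same stage. -/
theorem Ent.exists_ask (hf : (fac E).WeaklyConsistent ([] : List ℕ)) {p s k : ℕ} {e : Entry}
    (h : Ent E p s e k) :
    ∃ k' < k, ∃ q log x, loc E q k' = .ask log x ∧ log.length = s ∧ e.1 = x.1 := by
  obtain ⟨m, hm, log, x, hl, rfl, k₁, l, hk₁, hr, rfl⟩ := h.origin
  unfold entry
  split_ifs with hs
  · obtain ⟨c, hc, hcs, hold⟩ := exists_oldest (s := log.length) (c := Nat.pair log.length x.1)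
      (l := l) (by simp)
    rw [hold]
    rcases List.mem_cons.1 hc with rfl | hc
    · exact ⟨m, hm, p, log, x, hl, rfl, by simp⟩
    · obtain ⟨k', hk', q, hq⟩ := hf.exists_fac hr hc
      obtain ⟨log', x', hl', rfl⟩ := ask_of_fac hq
      exact ⟨k', by omega, q, log', x', hl', by simpa using hcs, by simp⟩
  · exact ⟨m, hm, p, log, x, hl, rfl, rfl⟩

theorem Ent.ask_of_odd {p s k : ℕ} {e : Entry} (h : Ent E p s e k) (hs : ¬ Even s) :
    ∃ k' < k, ∃ log, loc E p k' = .ask log e ∧ log.length = s := by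
  obtain ⟨m, hm, log, x, hl, rfl, k₁, l, hk₁, hr, rfl⟩ := h.origin
  rw [show entry log.length x l = x from if_neg hs]
  exact ⟨m, hm, log, hl, rfl⟩

/-- The value that a process passes on or decides at the end of a stage is the value of an entry of
this stage. -/
theorem exists_ent_of_next (hreg : ∀ i, (reg E i).Linearizable []) {p k : ℕ} {log : List Entry}
    {e : Entry} {acc : List Entry} (h : loc E p k = .get log e 0 acc) {x : ℕ}
    (hx : (∃ log' b, next log e acc = .ask log' (x, b)) ∨ ∃ log', next log e acc = .done log' x) :
    ∃ q y, Ent E q log.length y k ∧ y.1 = x := by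
  unfold next at hx
  split_ifs at hx with h1 h2
  · rcases hx with ⟨log', b, hx⟩ | ⟨log', hx⟩ <;> cases hx
    exact ⟨p, e, ent_get h, rfl⟩
  · rcases hx with ⟨log', b, hx⟩ | ⟨log', hx⟩ <;> cases hx
    exact ⟨p, e, ent_get h, rfl⟩
  · rcases hx with ⟨log', b, hx⟩ | ⟨log', hx⟩
    · have hx := congrArg Prod.fst (Loc.ask.inj hx).2
      rcases hfind : acc.find? (fun y => y.2) with _ | y
      · rw [hfind] at hx
        exact ⟨p, e, ent_get h, hx⟩
      · rw [hfind] at hx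
        obtain ⟨-, -, -, -, -, -, -, -, hacc, -⟩ := get_spec hreg h
        obtain ⟨q, -, hE⟩ := hacc y (List.mem_of_find?_eq_some hfind)
        exact ⟨q, y, hE, hx⟩
    · cases hx

/-- Every input value of a stage has been proposed before. -/
theorem ask_valid (hf : (fac E).WeaklyConsistent ([] : List ℕ))
    (hreg : ∀ i, (reg E i).Linearizable []) {p k : ℕ} {log : List Entry} {x : Entry}
    (h : loc E p k = .ask log x) : ∃ k' < k, ∃ q, E.hist k' = some (.inv q x.1) := by
  induction k using Nat.strong_induction_on generalizing p log x with
  | _ k ih =>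
  rcases ask_origin h with ⟨-, k', hk', hi⟩ | ⟨k', hk', log₀, e, acc, hg, hn⟩
  · exact ⟨k', hk', p, hi⟩
  · obtain ⟨q, y, hE, hy⟩ := exists_ent_of_next hreg hg (x := x.1) (.inl ⟨log, x.2, hn⟩)
    obtain ⟨k₁, hk₁, q', log', x', hl, -, hyx⟩ := hE.exists_ask hf
    obtain ⟨k₂, hk₂, r, hr⟩ := ih k₁ (by omega) hl
    exact ⟨k₂, by omega, r, by rw [hr, ← hyx, hy]⟩

/-- Validity: a decided value has been proposed before. -/
theorem done_valid (hf : (fac E).WeaklyConsistent ([] : List ℕ))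
    (hreg : ∀ i, (reg E i).Linearizable []) {p k : ℕ} {log : List Entry} {d : ℕ}
    (h : loc E p k = .done log d) : ∃ k' < k, ∃ q, E.hist k' = some (.inv q d) := by
  obtain ⟨k', hk', log₀, e, acc, hg, hn⟩ := done_origin h
  obtain ⟨q, y, hE, hy⟩ := exists_ent_of_next hreg hg (x := d) (.inr ⟨log, hn⟩)
  obtain ⟨k₁, hk₁, q', log', x', hl, -, hyx⟩ := hE.exists_ask hf
  obtain ⟨k₂, hk₂, r, hr⟩ := ask_valid hf hreg hl
  exact ⟨k₂, by omega, r, by rw [hr, ← hyx, hy]⟩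

theorem ask_succ_origin {p k s : ℕ} {log : List Entry} {x : Entry} (h : loc E p k = .ask log x)
    (hs : log.length = s + 1) :
    ∃ k' < k, ∃ log₀ e acc, loc E p k' = .get log₀ e 0 acc ∧ next log₀ e acc = .ask log x ∧
      log₀.length = s := by
  rcases ask_origin h with ⟨rfl, -⟩ | ⟨k', hk', log₀, e, acc, hg, hn⟩
  · cases hs
  · refine ⟨k', hk', log₀, e, acc, hg, hn, ?_⟩
    have := congrArg Loc.log hn
    rw [log_next] at this
    have hlen : log₀.length + 1 = log.length := by
      simpa [Loc.log] using congrArg List.length this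
    omega

/-- A flagged entry of an odd stage has the value that all entries seen in the preceding stage
have. -/
theorem Ent.flagged_origin {p s k : ℕ} {y : ℕ} (h : Ent E p s (y, true) k) (hs : ¬ Even s) :
    ∃ k' < k, ∃ log e acc, loc E p k' = .get log e 0 acc ∧ log.length + 1 = s ∧ e.1 = y ∧
      ∀ z ∈ acc, z.1 = y := by
  obtain ⟨k₁, hk₁, log, hl, hlen⟩ := h.ask_of_odd hs
  obtain ⟨r, rfl⟩ : ∃ r, s = r + 1 := by
    rcases s with _ | r
    · simp at hs
    · exact ⟨r, rfl⟩
  obtain ⟨k₂, hk₂, log₀, e, acc, hg, hn, hlen₀⟩ := ask_succ_origin hl hlen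
  have hev : Even log₀.length := by
    rw [hlen₀]
    simpa [Nat.even_add_one] using hs
  rw [next, if_pos hev] at hn
  have hn := (Loc.ask.inj hn).2
  have h1 : e.1 = y := congrArg Prod.fst hn
  have h2 : ∀ z ∈ acc, z.1 = e.1 := of_decide_eq_true (congrArg Prod.snd hn)
  exact ⟨k₂, by omega, log₀, e, acc, hg, by omega, h1, fun z hz => (h2 z hz).trans h1⟩

/-- All flagged entries of an odd stage have the same value. -/
theorem Ent.flagged_unique (hreg : ∀ i, (reg E i).Linearizable []) {p q s k k' : ℕ} {y y' : ℕ}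
    (h : Ent E p s (y, true) k) (h' : Ent E q s (y', true) k') (hs : ¬ Even s) : y = y' := by
  obtain ⟨_, -, log, e, acc, hg, hlen, hy, hacc⟩ := h.flagged_origin hs
  obtain ⟨_, -, log', e', acc', hg', hlen', hy', hacc'⟩ := h'.flagged_origin hs
  rcases mem_or_mem hreg hg hg' (by omega) with h | h
  · rw [← hy', hacc _ h]
  · rw [← hy, hacc' _ h]

theorem next_eq_done {log e acc log' d} (h : next log e acc = .done log' d) :
    ¬ Even log.length ∧ log' = log ++ [e] ∧ e.1 = d ∧ ∀ y ∈ acc, y = (d, true) := by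
  unfold next at h
  split_ifs at h with h1 h2
  cases h
  exact ⟨h1, rfl, rfl, h2⟩

/-- If some process decides `d` in a stage, then all processes decide or pass on `d`. -/
theorem next_of_done (hreg : ∀ i, (reg E i).Linearizable []) {p q k k' : ℕ}
    {log log' log₁ : List Entry} {e e' : Entry} {acc acc' : List Entry} {d : ℕ}
    (h : loc E p k = .get log e 0 acc) (hd : next log e acc = .done log₁ d)
    (h' : loc E q k' = .get log' e' 0 acc') (hs : log.length = log'.length) :
    (∃ b, next log' e' acc' = .ask (log' ++ [e']) (d, b)) ∨
      next log' e' acc' = .done (log' ++ [e']) d := by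
  obtain ⟨hodd, -, hed, hacc⟩ := next_eq_done hd
  obtain rfl := hacc _ (self_mem hreg h)
  have hodd' : ¬ Even log'.length := hs ▸ hodd
  have flag : ∀ y ∈ acc', y.2 = true → y.1 = d := by
    rintro ⟨y, _⟩ hy rfl
    obtain ⟨-, -, -, -, -, -, -, -, hacc', -⟩ := get_spec hreg h'
    obtain ⟨r, -, hE⟩ := hacc' _ hy
    exact hE.flagged_unique hreg (hs ▸ ent_get h) hodd'
  unfold next
  rw [if_neg hodd']
  split_ifs with hall
  · right
    have he' := hall _ (self_mem hreg h')
    rw [flag e' (self_mem hreg h') (by rw [he'])]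
  · left
    rcases hfind : acc'.find? (fun y => y.2) with _ | y
    · rcases mem_or_mem hreg h h' hs with hm | hm
      · have hv : e'.1 = d := congrArg Prod.fst (hacc _ hm)
        exact ⟨e'.2, by rw [hfind, Option.getD_none, ← hv]⟩
      · exact absurd rfl (List.find?_eq_none.1 hfind _ hm)
    · refine ⟨y.2, ?_⟩
      rw [hfind, Option.getD_some, ← flag y (List.mem_of_find?_eq_some hfind) (by
        simpa using List.find?_some hfind)]

/-- If all inputs of a stage have value `d`, then so have all inputs and decisions after it. -/
theorem value_of_le (hf : (fac E).WeaklyConsistent ([] : List ℕ))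
    (hreg : ∀ i, (reg E i).Linearizable []) {s d : ℕ}
    (h : ∀ q k log x, loc E q k = .ask log x → log.length = s → x.1 = d) {t : ℕ} (hst : s ≤ t) :
    (∀ q k log x, loc E q k = .ask log x → log.length = t → x.1 = d) ∧
      ∀ q k log x, loc E q k = .done log x → log.length = t + 1 → x = d := by
  have out : ∀ t, (∀ q k log x, loc E q k = .ask log x → log.length = t → x.1 = d) →
      ∀ q k log e acc x, loc E q k = .get log e 0 acc → log.length = t →
      ((∃ log' b, next log e acc = .ask log' (x, b)) ∨ ∃ log', next log e acc = .done log' x) →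
      x = d := by
    rintro t ht q k log e acc x hg rfl hx
    obtain ⟨q', y, hE, rfl⟩ := exists_ent_of_next hreg hg hx
    obtain ⟨k', -, q₁, log₁, x₁, hl, hlen, hy⟩ := hE.exists_ask hf
    rw [hy, ht _ _ _ _ hl hlen]
  have ask : ∀ q k log x, loc E q k = .ask log x → log.length = t → x.1 = d := by
    induction t, hst using Nat.le_induction with
    | base => exact h
    | succ t _ ih =>
      intro q k log x hl hlen
      obtain ⟨k', -, log₀, e, acc, hg, hn, hlen₀⟩ := ask_succ_origin hl hlen
      exact out t ih q k' log₀ e acc x.1 hg hlen₀ (.inl ⟨log, x.2, hn⟩)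
  refine ⟨ask, fun q k log x hl hlen => ?_⟩
  obtain ⟨k', -, log₀, e, acc, hg, hn⟩ := done_origin hl
  obtain ⟨-, rfl, -⟩ := next_eq_done hn
  exact out t ask q k' log₀ e acc x hg (by simpa using hlen) (.inr ⟨_, hn⟩)

/-- Agreement: no two processes decide different values. -/
theorem done_unique (hf : (fac E).WeaklyConsistent ([] : List ℕ))
    (hreg : ∀ i, (reg E i).Linearizable []) {p q k k' : ℕ} {log log' : List Entry} {d d' : ℕ}
    (h : loc E p k = .done log d) (h' : loc E q k' = .done log' d') : d = d' := by
  wlog hle : log.length ≤ log'.length generalizing p q k k' log log' d d'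
  · exact (this h' h (le_of_not_ge hle)).symm
  obtain ⟨k₁, -, log₀, e, acc, hg, hn⟩ := done_origin h
  obtain ⟨k₁', -, log₀', e', acc', hg', hn'⟩ := done_origin h'
  obtain ⟨-, rfl, -⟩ := next_eq_done hn
  obtain ⟨-, rfl, -⟩ := next_eq_done hn'
  simp only [List.length_append, List.length_singleton, add_le_add_iff_right] at hle
  rcases Nat.lt_or_eq_of_le hle with hlt | heq
  · symm
    refine (value_of_le hf hreg (s := log₀.length + 1) (d := d) ?_ (t := log₀'.length) hlt).2
      _ _ _ _ h' (by simp)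
    intro r k log x hl hlen
    obtain ⟨k₂, -, log₂, e₂, acc₂, hg₂, hn₂, hlen₂⟩ := ask_succ_origin hl hlen
    rcases next_of_done hreg hg hn hg₂ hlen₂.symm with ⟨b, hb⟩ | hb <;>
      cases hn₂.symm.trans hb
    rfl
  · rcases next_of_done hreg hg hn hg' heq with ⟨b, hb⟩ | hb <;> cases hn'.symm.trans hb
    rfl

/-- The algorithm implements linearizable consensus, as far as safety is concerned. -/
theorem hist_linearizable (hf : (fac E).WeaklyConsistent ([] : List ℕ))
    (hreg : ∀ i, (reg E i).Linearizable []) : E.hist.Linearizable (none : Option ℕ) := by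
  have hdone : ∀ {m p d}, E.hist m = some (.res p d) → ∃ log, loc E p m = .done log d := by
    intro m p d hm
    obtain ⟨-, -, ha⟩ := Execution.running_of_res hm
    rcases hl : loc E p m with _ | ⟨log, x⟩ | ⟨log, e⟩ | ⟨log, e, _ | i, acc⟩ | ⟨log, d⟩ <;>
      rw [show E.loc p m = _ from hl] at ha
    · cases ha
    · cases ha
    · simp only [program] at ha
      split_ifs at ha
    · cases ha
    · simp only [program] at ha
      split_ifs at ha
    · cases (Action.ret.inj ha).1
      exact ⟨log, rfl⟩
  by_cases hres : ∃ m p d, E.hist m = some (.res p d)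
  · classical
    obtain ⟨p, d, hm⟩ := Nat.find_spec hres
    obtain ⟨log, hl⟩ := hdone hm
    obtain ⟨k₀, hk₀, q₀, hq₀⟩ := done_valid hf hreg hl
    refine History.linearizable_consensus E.hist_wellFormed hq₀ fun m' p' d' hm' => ⟨?_, ?_⟩
    · obtain ⟨log', hl'⟩ := hdone hm'
      exact done_unique hf hreg hl' hl
    · exact hk₀.trans_le (Nat.find_min' hres ⟨p', d', hm'⟩)
  · push Not at hres
    have hno : ∀ k m v, ¬ E.hist.Returns k m v := by
      rintro k m v ⟨p, i, -, -, hm, -⟩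
      exact hres m p v hm
    exact ⟨E.hist_wellFormed, fun _ => none,
      ⟨fun _ _ _ _ _ h => (nomatch h), fun _ => none, rfl, fun j => ⟨fun _ => rfl,
        fun _ _ h => (nomatch h)⟩⟩,
      fun k m v hr => absurd hr (hno k m v), fun k m v _ _ _ hr => absurd hr (hno k m v),
      fun k m v hr => absurd hr (hno k m v)⟩

/-! ### Termination -/

theorem loc_ne_fresh {p k : ℕ} (h : ∀ l, E.status k p ≠ .idle l) : loc E p k ≠ .fresh := by
  induction k with
  | zero => exact absurd (E.status_zero p) (h _)
  | succ k ih =>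
    intro hl
    have hk : loc E p k = .fresh := by
      rcases moves E p k with h' | ⟨hl, v, hv, h'⟩ | ⟨log, x, _, k₁, hk₁, l, hf, hr, h'⟩ |
        ⟨_, _, _, _, -, _, -, -, h'⟩ | ⟨_, _, _, _, _, _, -, -, _, -, -, -, h'⟩ |
        ⟨log₀, e, acc, _, h'⟩
      · exact h' ▸ hl
      · exact hl
      · cases h'.symm.trans hl
      · cases h'.symm.trans hl
      · cases h'.symm.trans hl
      · have := h'.symm.trans hl
        unfold next at this
        split_ifs at this
    have hidle : ∃ l, E.status k p = .idle l := by
      by_contra! hne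
      exact ih hne hk
    obtain ⟨l, hidle⟩ := hidle
    rcases E.localStep_or p k with ⟨-, hs⟩ | ⟨-, hs⟩
    · rw [hidle] at hs
      obtain ⟨v, -, -, hs⟩ := hs
      have h1 : l = .fresh := (Execution.loc_of_idle hidle).symm.trans hk
      subst h1
      cases hl.symm.trans (Execution.loc_of_running hs)
    · exact h l (hs.trans hidle)

/-- A bound for the number of responses that a process gets before it announces its next entry
or decides. -/
def weight (n : ℕ) : Loc → ℕ
  | .fresh => 0
  | .ask _ _ => 1
  | .put _ _ => n + 3
  | .get _ _ i _ => i + 2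
  | .done _ _ => 0

theorem weight_next (log : List Entry) (e : Entry) (acc : List Entry) :
    weight n (next log e acc) ≤ 1 := by
  unfold next
  split_ifs <;> simp [weight]

open Classical in
/-- A bound for the number of steps that a process takes before it announces its next entry
or decides. -/
noncomputable def rank (E : Execution (program n) n) (p k : ℕ) : ℕ :=
  2 * weight n (loc E p k) + if ∃ l, E.status k p = .running l then 1 else 0

theorem rank_le (hreg : ∀ i, (reg E i).Linearizable []) (p k : ℕ) :
    rank E p k ≤ 2 * n + 7 := by
  have hw : weight n (loc E p k) ≤ n + 3 := by
    rcases hl : loc E p k with _ | ⟨log, x⟩ | ⟨log, e⟩ | ⟨log, e, i, acc⟩ | ⟨log, d⟩ <;>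
      simp only [weight] <;> try omega
    have := (get_spec hreg hl).1
    omega
  unfold rank
  split_ifs <;> omega

theorem rank_of_not_actor {p k : ℕ} (h : E.status (k + 1) p = E.status k p) :
    rank E p (k + 1) = rank E p k := by
  unfold rank loc
  rw [Execution.loc_succ_of_status h, h]

theorem rank_of_actor (hreg : ∀ i, (reg E i).Linearizable []) {p k : ℕ} (ha : E.actor k = some p)
    (hk : ∀ l, E.status k p ≠ .idle l) (hk' : ∀ l, E.status (k + 1) p ≠ .idle l) :
    (loc E p k).log.length < (loc E p (k + 1)).log.length ∨
      rank E p (k + 1) < rank E p k := by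
  have hp := E.actor_lt k p ha
  have hfresh := loc_ne_fresh hk
  rcases E.localStep_or p k with ⟨-, hs⟩ | ⟨hne, -⟩
  swap
  · exact absurd ha hne
  rcases hst : E.status k p with l | l | ⟨o, nx⟩
  · exact absurd hst (hk l)
  · rw [hst] at hs
    have hl : loc E p k = l := Execution.loc_of_running hst
    have call : ∀ {o nx}, E.status (k + 1) p = .waiting o nx → rank E p (k + 1) < rank E p k := by
      intro o nx hw
      unfold rank loc
      rw [Execution.loc_succ_of_waiting hw, hw, hst]
      simp
    rcases l with _ | ⟨log, x⟩ | ⟨log, e⟩ | ⟨log, e, _ | i, acc⟩ | ⟨log, d⟩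
    · exact absurd hl hfresh
    · exact .inr (call hs.2.2)
    · simp only [Program.LocalStep, program, dif_pos hp] at hs
      exact .inr (call hs.2.2)
    · right
      have hn : loc E p (k + 1) = next log e acc := Execution.loc_of_running hs.2.2
      have hw := weight_next (n := n) log e acc
      have h5 : rank E p k = 5 := by
        rw [rank, hl, if_pos ⟨_, hst⟩]
        rfl
      have h3 : rank E p (k + 1) ≤ 3 := by
        rw [rank, hn]
        split_ifs <;> omega
      omega
    · have hi := (get_spec hreg hl).1
      simp only [Program.LocalStep, program, dif_pos (show i < n by omega)] at hs
      exact .inr (call hs.2.2)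
    · exact absurd hs.2.2 (hk' _)
  · rw [hst] at hs
    obtain ⟨k₁, -, i, hact, -⟩ := Execution.exists_call_of_waiting hst
    obtain ⟨v, -, -, hs⟩ := hs
    have hn := Execution.loc_of_running hs
    have hrank : weight n (loc E p (k + 1)) < weight n (loc E p k) →
        rank E p (k + 1) < rank E p k := by
      intro h
      unfold rank
      split_ifs <;> omega
    rcases hl : loc E p k with _ | ⟨log, x⟩ | ⟨log, e⟩ | ⟨log, e, _ | i, acc⟩ | ⟨log, d⟩ <;>
      rw [show E.loc p k = _ from hl] at hact
    · cases hact
    · cases hact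
      left
      rw [show loc E p (k + 1) = _ from hn]
      simp [Loc.log]
    · simp only [program, dif_pos hp] at hact
      cases hact
      refine .inr (hrank ?_)
      rw [show loc E p (k + 1) = _ from hn, hl]
      simp [weight]
    · cases hact
    · simp only [program] at hact
      split_ifs at hact
      cases hact
      refine .inr (hrank ?_)
      rw [show loc E p (k + 1) = _ from hn, hl]
      simp [weight]
    · cases hact

/-- A process that takes infinitely many steps in one operation goes through all stages. -/
theorem exists_stage (hreg : ∀ i, (reg E i).Linearizable []) {p k₀ : ℕ}
    (hinf : {k | E.actor k = some p}.Infinite) (hk₀ : ∀ k ≥ k₀, ∀ l, E.status k p ≠ .idle l)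
    (N : ℕ) : ∃ k, N ≤ (loc E p k).log.length := by
  by_contra! hN
  refine not_strict_descent hinf (K := k₀)
    (f := fun k => (N - (loc E p k).log.length) * (2 * n + 8) + rank E p k) ?_ ?_
  all_goals
    have strict : ∀ k ≥ k₀, E.actor k = some p →
        (N - (loc E p (k + 1)).log.length) * (2 * n + 8) + rank E p (k + 1) <
          (N - (loc E p k).log.length) * (2 * n + 8) + rank E p k := by
      intro k hk ha
      have hle := (log_mono (E := E) (p := p) (Nat.le_add_right k 1)).length_le
      have h1 := rank_le hreg p (k + 1)
      have h2 := hN (k + 1)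
      rcases rank_of_actor hreg ha (hk₀ k hk) (hk₀ (k + 1) (by omega)) with h | h
      · obtain ⟨d, hd⟩ : ∃ d, N - (loc E p k).log.length =
            N - (loc E p (k + 1)).log.length + 1 + d :=
          ⟨(loc E p (k + 1)).log.length - (loc E p k).log.length - 1, by omega⟩
        rw [hd, add_mul, add_mul, one_mul]
        have := Nat.zero_le (d * (2 * n + 8))
        omega
      · exact add_lt_add_of_le_of_lt (Nat.mul_le_mul_right _ (by omega)) h
  · intro k hk
    rcases E.localStep_or p k with ⟨ha, -⟩ | ⟨-, hs⟩
    · exact (strict k hk ha).le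
    · have : loc E p (k + 1) = loc E p k := Execution.loc_succ_of_status hs
      simp only [this, rank_of_not_actor hs]
      exact le_rfl
  · exact fun k hk ha => strict k hk ha

/-- The algorithm is wait-free: once fetch-and-cons has stabilized, all entries of an even stage
have the same value, hence all entries of the next stage are flagged, and everybody who completes
it decides. -/
theorem waitFree {t : ℕ} (hf : (fac E).TLinearizable ([] : List ℕ) t)
    (hreg : ∀ i, (reg E i).Linearizable []) : E.WaitFree := by
  intro p hinf k₀
  by_contra! hno
  have hstage := exists_stage hreg hinf hno
  obtain ⟨-, S, hS⟩ := hf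
  have hp : p < n := by
    obtain ⟨k, hk⟩ := hinf.nonempty
    exact E.actor_lt k p hk
  have late : ∀ {q s e k K}, Ent E q s e k → (loc E q K).log.length < s → ∃ m ≥ K, ∃ x k₁ l,
      fac E k₁ = some (.inv q (Nat.pair s x)) ∧ (fac E).Returns k₁ m l ∧
      (Even s → e = (oldest s (Nat.pair s x) l, true)) := by
    intro q s e k K hE hK
    obtain ⟨m, hm, log, x, hl, rfl, k₁, l, hk₁, hr, rfl⟩ := hE.origin
    refine ⟨m, ?_, x.1, k₁, l, hk₁, hr, fun hs => if_pos hs⟩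
    by_contra hlt
    have hle : (loc E q m).log.length ≤ (loc E q K).log.length :=
      (log_mono (not_le.1 hlt).le).length_le
    rw [hl] at hle
    exact absurd (hle.trans_lt hK) (lt_irrefl _)
  have ent : ∀ {s k}, s < (loc E p k).log.length → ∃ e, Ent E p s e k :=
    fun h => ⟨_, List.getElem?_eq_getElem h⟩
  have hevents : {j | fac E j ≠ none}.Infinite := by
    intro hfin
    obtain ⟨J, hJ⟩ := hfin.bddAbove
    obtain ⟨k, hk⟩ := hstage ((loc E p (J + 1)).log.length + 2)
    obtain ⟨e, he⟩ := ent (s := (loc E p (J + 1)).log.length + 1) (k := k) (by omega)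
    obtain ⟨m, hm, x, k₁, l, -, ⟨_, _, _, _, hres, _⟩, -⟩ := late (K := J + 1) he (by omega)
    have : m ≤ J := hJ (by simp [hres])
    omega
  obtain ⟨K, hK⟩ := History.exists_inSuffix hevents t
  -- an even stage that no process has reached at instant `K`
  obtain ⟨s, hs, hsK⟩ : ∃ s, Even s ∧ ∀ q < n, (loc E q K).log.length < s := by
    refine ⟨2 * (∑ q ∈ Finset.range n, (loc E q K).log.length + 1), even_two_mul _,
      fun q hq => ?_⟩
    have := Finset.single_le_sum (f := fun q => (loc E q K).log.length)
      (fun _ _ => Nat.zero_le _) (Finset.mem_range.2 hq)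
    omega
  have common : ∀ {q q' e e' k k'}, q < n → q' < n → Ent E q s e k → Ent E q' s e' k' →
      e = e' := by
    intro q q' e e' k k' hq hq' hE hE'
    obtain ⟨m, hm, x, k₁, l, hk₁, hr, he⟩ := late hE (hsK q hq)
    obtain ⟨m', hm', x', k₁', l', hk₁', hr', he'⟩ := late hE' (hsK q' hq')
    obtain ⟨j, hj⟩ := hS.response k₁ m l hr (hK m hm)
    obtain ⟨j', hj'⟩ := hS.response k₁' m' l' hr' (hK m' hm')
    rw [he hs, he' hs]
    rcases lt_trichotomy j j' with hlt | rfl | hlt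
    · rw [oldest_eq_of_suffix (by simp) (hS.legal.fac_suffix hj hj' hlt hk₁)]
    · cases hj.symm.trans hj'
      rw [(Event.inv.inj (Option.some.inj (hk₁.symm.trans hk₁'))).2]
    · rw [oldest_eq_of_suffix (by simp) (hS.legal.fac_suffix hj' hj hlt hk₁')]
  have hs₁ : ¬ Even (s + 1) := by simpa [Nat.even_add_one] using hs
  obtain ⟨k, hk⟩ := hstage (s + 3)
  obtain ⟨z, hz⟩ := ent (s := s) (k := k) (by omega)
  have flagged : ∀ {q y k'}, q < n → Ent E q (s + 1) y k' → y = (z.1, true) := by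
    intro q y k' hq hE
    obtain ⟨k₁, -, log, hl, hlen⟩ := hE.ask_of_odd hs₁
    obtain ⟨k₂, -, log₀, e₀, acc, hg, hn, rfl⟩ := ask_succ_origin hl hlen
    rw [next, if_pos hs] at hn
    have he₀ : e₀ = z := common hq hp (ent_get hg) hz
    rw [← (Loc.ask.inj hn).2, he₀]
    obtain ⟨-, -, -, -, -, -, -, -, hacc, -⟩ := get_spec hreg hg
    refine Prod.ext rfl (decide_eq_true fun y hy => ?_)
    obtain ⟨r, hr, hy⟩ := hacc y hy
    exact congrArg Prod.fst (common hr hp hy hz)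
  obtain ⟨e, he⟩ := ent (s := s + 2) (k := k) (by omega)
  obtain ⟨m, -, log, x, hl, hlen, -⟩ := he.origin
  obtain ⟨k₂, -, log₀, e₀, acc, hg, hn, hlen₀⟩ := ask_succ_origin hl hlen
  obtain ⟨-, -, -, -, -, -, -, -, hacc, -⟩ := get_spec hreg hg
  rw [next, if_neg (by rwa [hlen₀]), if_pos fun y hy => ?_] at hn
  · cases hn
  · obtain ⟨q, hq, hy⟩ := hacc y hy
    rw [hlen₀] at hy
    have he₀ : e₀ = (z.1, true) := flagged hp (hlen₀ ▸ ent_get hg)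
    rw [flagged hq hy, he₀]

end ConsensusAlgorithm

/-- Eventually linearizable fetch-and-cons and registers implement linearizable consensus. -/
theorem implementsFrom_consensus (n : ℕ) :
    ImplementsFrom .eventual .linearizable n fetchAndCons consensus (none : Option ℕ) := by
  refine ⟨Unit, Fin n, inferInstance, inferInstance, fun _ => ([] : List ℕ), fun _ => rfl,
    fun _ => List ConsensusAlgorithm.Entry, fun _ => [], ConsensusAlgorithm.program n,
    fun E hobj hreg => ?_⟩
  obtain ⟨-, hw, t, ht⟩ := hobj ()
  exact ⟨ConsensusAlgorithm.hist_linearizable hw hreg, ConsensusAlgorithm.waitFree ht hreg⟩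

theorem Implements.consensus {n : ℕ} {T : DataType.{u}}
    (h : Implements .eventual n T fetchAndCons) : Implements .linearizable n T consensus := by
  rintro x (rfl : x = none)
  exact ImplementsFrom.comp.{u, 0, 0} (fun x hx => h.from_linearizable hx)
    (implementsFrom_consensus n)

end SharedMemory

open SharedMemory
theorem theorem11 :
    (∀ T : DataType.{u}, eventualConsensusNumber T ≤ consensusNumber T) ∧
    (∀ T₁ T₂ : DataType.{u}, eventualConsensusNumber T₁ < eventualConsensusNumber T₂ →
      ∀ n : ℕ, eventualConsensusNumber T₁ < n → ¬ Implements .eventual n T₁ T₂) := by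
  refine ⟨fun T => biSup_mono fun n hn => Implements.consensus hn, ?_⟩
  intro T₁ T₂ hlt n hn h
  obtain ⟨m, hm, hlt⟩ := lt_biSup_iff.1 hlt
  -- `T₁` implements fetch-and-cons by way of `T₂`, for the smaller number of processes
  have hmin : Implements .eventual (min n m) T₁ fetchAndCons :=
    (h.mono (min_le_left n m)).trans (Implements.mono (min_le_right n m) hm)
  have hle : ((min n m : ℕ) : ℕ∞) ≤ eventualConsensusNumber T₁ :=
    le_iSup₂ (f := fun (n : ℕ) (_ : n ∈ {n | Implements .eventual n T₁ fetchAndCons}) => (n : ℕ∞))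
      (min n m) hmin
  rw [Nat.mono_cast.map_min] at hle
  exact absurd hle (not_le.2 (lt_min hn hlt))
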